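/- Let $$\vartheta_2(\tau)=e^{\frac14\pi i\tau}\sum_{k\in\mathbb Z}e^{(k^2+k)\pi i\tau},\quad \vartheta_3(\tau)=\sum_{k\in\mathbb Z}e^{k^2\pi i\tau},\quad \vartheta_4(\tau)=\sum_{k\in\mathbb Z}(-1)^ke^{k^2\pi i\tau},\quad \eta(\tau)=2\pi^2\Big\{\frac1{24}-\sum_{k\ge1}\frac{e^{2k\pi i\tau}}{(1-e^{2k\pi i\tau})^2}\Big\}$$ for $\operatorname{Im}\tau>0$. Consider, for holomorphic functions of a complex variable $\tau$ on an open set $U\subseteq\mathbb C$ (a dot denotes $d/d\tau$), the canonical system $$\dot x=(u+y^2+z^2)x,\quad \dot y=(u+y^2-2z^2)y,\quad \dot z=(u-2y^2+z^2)z,\quad \dot u=u^2-y^4+y^2z^2-z^4 \tag{C}$$ and Jacobi's system $$\dot A=2A^2B,\quad \dot B=bA^3,\quad \dot a=-16bA^2,\quad \dot b=abA^2. \tag{J}$$ **(1) Equivalence.** If $(x,y,z,u)$ solves (C) on a connected open set $U$ and $x\ne0$, $y\neq 0$, $y^2\ne z^2$ at one point of $U$, then these inequalities hold on all of $U$ and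 there is a constant $I\ne0$ with $\pi I^2=(y^2-z^2)/x^2$ on $U$. Consider the point transformation $$A=\frac{1-i}{2I}\,y,\quad B=\frac{1+i}{2}\,\frac Iy\,(u+y^2-2z^2),\quad a=\frac{12}{\pi i}\,\frac{y^2-z^2}{x^2}\,\frac{y^2-2z^2}{y^2},\quad b=-\frac{18}{\pi^2}\,\frac{z^2}{x^4y^4}\,(y^2-z^2)^3, \tag{T}$$ where $I\neq0$, $x\ne0$, $y\ne0$ and $\pi I^2=(y^2-z^2)/x^2$. If functions $x,y,z,u,A,B,a,b$ on an open set $U$ are related by (T) with a constant $I$, and $x,z$ are continuous, then $(x,y,z,u)$ solves (C) on $U$ if and only if $(A,B,a,b)$ solves (J) on $U$. A point $(A,B,a,b)\in\mathbb C^4$ is the image under (T) of some $(I,x,y,z,u)$ if and only if $A\ne0$ and $a^2+32b\neq0$. If $U$ is open and simply connected, $\tau_0\in U$, $(A,B,a,b)$ solves (J) on $U$, and $(I,x_0,y_0,z_0,u_0)$ is a preimage under (T) of the value of $(A,B,a,b)$ at $\tau_0$, then there is a solution $(x,y,z,u)$ of (C) on $U$ with value $(x_0,y_0,z_0,u_0)$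 at $\tau_0$ that is related to $(A,B,a,b)$ by (T), with this $I$, on all of $U$. **(2) General solution of (C).** Fix either value of $\sqrt{\pi i/6}$ and put $\mathbb T=\frac{\alpha\tau+\beta}{\gamma\tau+\delta}$, where $\alpha,\beta,\gamma,\delta\in\mathbb C$ and $\alpha\delta-\beta\gamma=1$. For every $\varepsilon\in\mathbb C$ the functions $$x=\varepsilon\frac{\vartheta_2^2(\mathbb T)}{\gamma\tau+\delta},\quad y=\sqrt{\tfrac{\pi i}{6}}\,\frac{\vartheta_3^2(\mathbb T)}{\gamma\tau+\delta},\quad z=\sqrt{\tfrac{\pi i}{6}}\,\frac{\vartheta_4^2(\mathbb T)}{\gamma\tau+\delta},\quad u=\frac{2i}{\pi}\frac{\eta(\mathbb T)}{(\gamma\tau+\delta)^2}-\frac{\gamma}{\gamma\tau+\delta}$$ solve (C) on the set of all $\tau$ with $\gamma\tau+\delta\ne0$ and $\operatorname{Im}\mathbb T>0$. Conversely, every solution of (C) on a connected open set $U$ such that $y\neq0$, $z\ne0$, $y^2\ne z^2$ at some point $\tau_0\in U$ is of this form on $U$ (and $U$ is contained in that set) for some $\varepsilon,\alpha,\beta,\gamma,\delta$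 with $\alpha\delta-\beta\gamma=1$; here $\varepsilon\ne0$ if and only if $x(\tau_0)\ne0$. **(3) Elementary solutions.** For all $\gamma,\delta\in\mathbb C$ and either sign, $$x=0,\quad y=\frac{\pm1}{\gamma\tau+\delta},\quad z=\frac1{\gamma\tau+\delta},\quad u=-\frac{\gamma^2\tau+\gamma\delta-1}{(\gamma\tau+\delta)^2}$$ solve (C) on the set where $\gamma\tau+\delta\neq0$. Conversely, every solution of (C) on a connected open set $U$ such that $x=0$, $y^2=z^2$ and $z\ne0$ at some point of $U$ is of this form on $U$ for some $\gamma,\delta$ and some sign, with $\gamma\tau+\delta\ne0$ on $U$. -/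

import Mathlib

open Complex

noncomputable section

/-- The theta constant `ϑ₂(τ) = e^{πiτ/4} ∑_{k ∈ ℤ} e^{(k² + k)πiτ}` (for `Im τ > 0`). -/
def theta2 (τ : ℂ) : ℂ :=
  exp (Real.pi * I * τ / 4) * ∑' k : ℤ, exp (((k : ℂ) ^ 2 + k) * (Real.pi * I * τ))

/-- The theta constant `ϑ₃(τ) = ∑_{k ∈ ℤ} e^{k²πiτ}` (for `Im τ > 0`). -/
def theta3 (τ : ℂ) : ℂ :=
  ∑' k : ℤ, exp ((k : ℂ) ^ 2 * (Real.pi * I * τ))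

/-- The theta constant `ϑ₄(τ) = ∑_{k ∈ ℤ} (-1)^k e^{k²πiτ}` (for `Im τ > 0`). -/
def theta4 (τ : ℂ) : ℂ :=
  ∑' k : ℤ, (-1 : ℂ) ^ k * exp ((k : ℂ) ^ 2 * (Real.pi * I * τ))

/-- The Weierstrass function
`η(τ) = 2π² (1/24 - ∑_{k ≥ 1} e^{2kπiτ} / (1 - e^{2kπiτ})²)` (for `Im τ > 0`);
the summation index is shifted by one. -/
def weierstrassEta (τ : ℂ) : ℂ :=
  2 * (Real.pi : ℂ) ^ 2 *
    (1 / 24 - ∑' k : ℕ, exp (2 * ((k : ℂ) + 1) * (Real.pi * I * τ)) /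
      (1 - exp (2 * ((k : ℂ) + 1) * (Real.pi * I * τ))) ^ 2)

/-- Comparison with Mathlib's one-variable Jacobi theta function. -/
theorem theta3_eq_jacobiTheta (τ : ℂ) : theta3 τ = jacobiTheta τ := by
  unfold theta3 jacobiTheta
  refine tsum_congr fun k => ?_
  congr 1
  ring

/-- Comparison with Mathlib's two-variable Jacobi theta function. -/
theorem theta2_eq_jacobiTheta₂ (τ : ℂ) :
    theta2 τ = exp (Real.pi * I * τ / 4) * jacobiTheta₂ (τ / 2) τ := by
  unfold theta2 jacobiTheta₂ jacobiTheta₂_term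
  congr 1
  refine tsum_congr fun k => ?_
  congr 1
  ring

/-- Comparison with Mathlib's two-variable Jacobi theta function. -/
theorem theta4_eq_jacobiTheta₂ (τ : ℂ) : theta4 τ = jacobiTheta₂ (1 / 2) τ := by
  unfold theta4 jacobiTheta₂ jacobiTheta₂_term
  refine tsum_congr fun k => ?_
  rw [exp_add, ← exp_pi_mul_I, ← exp_int_mul]
  congr 2 <;> ring

/-- The linear fractional substitution `𝕋 = (ατ + β) / (γτ + δ)`. -/
def linFrac (α β γ δ τ : ℂ) : ℂ := (α * τ + β) / (γ * τ + δ)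

/-- The set of `τ` at which `γτ + δ ≠ 0` and `𝕋` lies in the upper half-plane. -/
def linFracDomain (α β γ δ : ℂ) : Set ℂ :=
  {τ | γ * τ + δ ≠ 0 ∧ 0 < (linFrac α β γ δ τ).im}

/-- `(x, y, z, u)` is a (holomorphic) solution on `U` of the canonical system
`ẋ = (u + y² + z²)x`, `ẏ = (u + y² - 2z²)y`, `ż = (u - 2y² + z²)z`,
`u̇ = u² - y⁴ + y²z² - z⁴`. -/
structure IsCanonicalSolution (U : Set ℂ) (x y z u : ℂ → ℂ) : Prop where
  hasDerivAt_x : ∀ τ ∈ U, HasDerivAt x ((u τ + y τ ^ 2 + z τ ^ 2) * x τ) τ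
  hasDerivAt_y : ∀ τ ∈ U, HasDerivAt y ((u τ + y τ ^ 2 - 2 * z τ ^ 2) * y τ) τ
  hasDerivAt_z : ∀ τ ∈ U, HasDerivAt z ((u τ - 2 * y τ ^ 2 + z τ ^ 2) * z τ) τ
  hasDerivAt_u : ∀ τ ∈ U,
    HasDerivAt u (u τ ^ 2 - y τ ^ 4 + y τ ^ 2 * z τ ^ 2 - z τ ^ 4) τ

/-- `(A, B, a, b)` is a (holomorphic) solution on `U` of Jacobi's system
`Ȧ = 2A²B`, `Ḃ = bA³`, `ȧ = -16bA²`, `ḃ = abA²`. -/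
structure IsJacobiSolution (U : Set ℂ) (A B a b : ℂ → ℂ) : Prop where
  hasDerivAt_A : ∀ τ ∈ U, HasDerivAt A (2 * A τ ^ 2 * B τ) τ
  hasDerivAt_B : ∀ τ ∈ U, HasDerivAt B (b τ * A τ ^ 3) τ
  hasDerivAt_a : ∀ τ ∈ U, HasDerivAt a (-16 * b τ * A τ ^ 2) τ
  hasDerivAt_b : ∀ τ ∈ U, HasDerivAt b (a τ * b τ * A τ ^ 2) τ

/-- The level relation `π κ² = (y² - z²) / x²`, at points where all the denominators of the
point transformation are nonzero. -/
structure OnLevel (κ x y z : ℂ) : Prop where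
  κ_ne : κ ≠ 0
  x_ne : x ≠ 0
  y_ne : y ≠ 0
  level : Real.pi * κ ^ 2 = (y ^ 2 - z ^ 2) / x ^ 2

/-- The point transformation between `(x, y, z, u)` and `(A, B, a, b)`; the square root
`κ` of `(y² - z²) / (π x²)` is a parameter. -/
structure PointRelated (κ x y z u A B a b : ℂ) : Prop extends OnLevel κ x y z where
  A_eq : A = (1 - I) / (2 * κ) * y
  B_eq : B = (1 + I) / 2 * (κ / y) * (u + y ^ 2 - 2 * z ^ 2)
  a_eq : a = 12 / (Real.pi * I) * ((y ^ 2 - z ^ 2) / x ^ 2) * ((y ^ 2 - 2 * z ^ 2) / y ^ 2)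
  b_eq : b = -(18 / (Real.pi : ℂ) ^ 2) * (z ^ 2 / (x ^ 4 * y ^ 4)) * (y ^ 2 - z ^ 2) ^ 3

end

open Complex

noncomputable section

/-! Equivalence. Along a solution of (C) both `x²` and `y² - z²` satisfy the linear equation with
coefficient `2(u + y² + z²)`, so their quotient is constant. Once it is fixed as `πκ²`, the
transformation becomes polynomial (`pointRelated_iff`): `A` is a multiple of `y`, while `2AB`, `aA²`
and `bA⁴` are polynomials in `u`, `y²`, `z²`. Each direction is then a differentiation. Going back
to (C) requires square roots for `x` and `z`; they exist on a simply connected set because a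
solution of a linear equation is either zero-free or identically zero.

Theta solutions. The generators of `SL(2, ℤ)` permute `ϑ₂²`, `ϑ₃²`, `ϑ₄²` up to elementary factors,
so suitable combinations are cusp forms of level one. These vanish in weight below 12 and are
multiples of `η²⁴` (Dedekind) in weight 12. This gives Jacobi's identity, the absence of zeros, the
logarithmic derivatives (`logDeriv_sqTheta_eq`), the derivative of their mean (`deriv_thetaU`) and
its identification with Weierstrass' `η`. Together these are (C) for the identity substitution; a
general one contributes the factor `(γτ + δ)⁻²` and the term `-γ / (γτ + δ)`.

Generality. Four parameters match four initial values, because `ϑ₄² / ϑ₃²` attains every value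
except `0` and `±1` (`exists_sqTheta4_eq`). Local uniqueness propagates the agreement, unless `U`
meets the boundary of the domain of the theta solution. This cannot happen: the modular invariant
`thetaHeight` has a positive lower bound, so `y` or `z` would be unbounded there. For the elementary
family the relation `z(γτ + δ) = 1` plays the same role. -/

/-! ### Linear differential equations on connected open sets. -/

/-- A function with `‖f'‖ ≤ K ‖f‖` on a disc vanishes there if it vanishes at the centre. -/
theorem eq_zero_of_norm_deriv_le {E : Type*} [NormedAddCommGroup E] [NormedSpace ℂ E]
    {f f' : ℂ → E} {τ₀ : ℂ} {r K : ℝ}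
    (hf : ∀ τ ∈ Metric.ball τ₀ r, HasDerivAt f (f' τ) τ)
    (hK : ∀ τ ∈ Metric.ball τ₀ r, ‖f' τ‖ ≤ K * ‖f τ‖) (h₀ : f τ₀ = 0) :
    ∀ τ ∈ Metric.ball τ₀ r, f τ = 0 := by
  intro τ hτ
  let _ : NormedSpace ℝ E := NormedSpace.restrictScalars ℝ ℂ E
  have hmem : ∀ t ∈ Set.Icc (0 : ℝ) 1, τ₀ + (t : ℂ) * (τ - τ₀) ∈ Metric.ball τ₀ r := by
    intro t ht
    rw [Metric.mem_ball, dist_eq_norm] at hτ ⊢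
    rw [add_sub_cancel_left, norm_mul, Complex.norm_real, Real.norm_of_nonneg ht.1]
    nlinarith [norm_nonneg (τ - τ₀), ht.2]
  have hd : ∀ t ∈ Set.Icc (0 : ℝ) 1, HasDerivAt (fun t : ℝ => f (τ₀ + (t : ℂ) * (τ - τ₀)))
      ((τ - τ₀) • f' (τ₀ + (t : ℂ) * (τ - τ₀))) t := by
    intro t ht
    have h1 : HasDerivAt (fun t : ℝ => τ₀ + (t : ℂ) * (τ - τ₀)) (τ - τ₀) t := by
      simpa using ((Complex.ofRealCLM.hasDerivAt (x := t)).mul_const (τ - τ₀)).const_add τ₀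
    exact (hf _ (hmem t ht)).scomp t h1
  -- Grönwall along the segment from the centre to `τ`, with initial value and inhomogeneity both
  -- zero.
  have := norm_le_gronwallBound_of_norm_deriv_right_le (δ := 0) (K := ‖τ - τ₀‖ * K) (ε := 0)
    (a := 0) (b := 1) (fun t ht => (hd t ht).continuousAt.continuousWithinAt)
    (fun t ht => (hd t ⟨ht.1, ht.2.le⟩).hasDerivWithinAt) (by simp [h₀])
    (fun t ht => by
      rw [norm_smul, add_zero, mul_assoc]
      exact mul_le_mul_of_nonneg_left (hK _ (hmem t ⟨ht.1, ht.2.le⟩)) (norm_nonneg _))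
    1 ⟨zero_le_one, le_rfl⟩
  simpa [gronwallBound_ε0_δ0] using this

/-- A solution of a linear equation `ḟ = p f` on a connected open set which vanishes at one point
vanishes identically. -/
theorem eqOn_zero_of_linear {U : Set ℂ} {f p : ℂ → ℂ} (hU : IsOpen U) (hc : IsPreconnected U)
    (hp : ContinuousOn p U) (hf : ∀ τ ∈ U, HasDerivAt f (p τ * f τ) τ)
    {τ₀ : ℂ} (h₀ : τ₀ ∈ U) (hz : f τ₀ = 0) : ∀ τ ∈ U, f τ = 0 := by
  have hcont : ContinuousOn f U := fun τ hτ => (hf τ hτ).continuousAt.continuousWithinAt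
  suffices U ⊆ {τ | τ ∈ U ∧ f τ = 0} from fun τ hτ => (this hτ).2
  refine hc.subset_of_closure_inter_subset ?_ ⟨τ₀, h₀, h₀, hz⟩ ?_
  · rw [Metric.isOpen_iff]
    rintro τ ⟨hτ, hfτ⟩
    have h1 : ∀ᶠ w in nhds τ, ‖p w‖ < ‖p τ‖ + 1 :=
      (hp.continuousAt (hU.mem_nhds hτ)).norm.eventually_lt_const (lt_add_one _)
    obtain ⟨r, hr, hb⟩ := Metric.eventually_nhds_iff_ball.1 (h1.and (hU.mem_nhds hτ))
    refine ⟨r, hr, fun w hw => ⟨(hb w hw).2, ?_⟩⟩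
    refine eq_zero_of_norm_deriv_le (K := ‖p τ‖ + 1) (fun w hw => hf w (hb w hw).2)
      (fun w hw => ?_) hfτ w hw
    rw [norm_mul]
    exact mul_le_mul_of_nonneg_right (hb w hw).1.le (norm_nonneg _)
  · rintro τ ⟨hτ, hτU⟩
    refine ⟨hτU, ?_⟩
    have h1 : ContinuousAt f τ := hcont.continuousAt (hU.mem_nhds hτU)
    have h2 := h1.continuousWithinAt.mem_closure_image hτ
    have h3 : f '' {τ | τ ∈ U ∧ f τ = 0} ⊆ {0} := by rintro _ ⟨w, hw, rfl⟩; exact hw.2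
    simpa using closure_mono h3 h2

theorem ne_zero_of_linear {U : Set ℂ} {f p : ℂ → ℂ} (hU : IsOpen U) (hc : IsPreconnected U)
    (hp : ContinuousOn p U) (hf : ∀ τ ∈ U, HasDerivAt f (p τ * f τ) τ)
    {τ₀ : ℂ} (h₀ : τ₀ ∈ U) (hz : f τ₀ ≠ 0) : ∀ τ ∈ U, f τ ≠ 0 :=
  fun _ hτ h => hz (eqOn_zero_of_linear hU hc hp hf hτ h τ₀ h₀)

theorem eqOn_of_hasDerivAt_zero {U : Set ℂ} {f : ℂ → ℂ} (hU : IsOpen U) (hc : IsPreconnected U)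
    (hf : ∀ τ ∈ U, HasDerivAt f 0 τ) {τ₀ : ℂ} (h₀ : τ₀ ∈ U) : ∀ τ ∈ U, f τ = f τ₀ := by
  intro τ hτ
  refine sub_eq_zero.1 (eqOn_zero_of_linear (f := fun τ => f τ - f τ₀) (p := fun _ => 0) hU hc
    continuousOn_const (fun w hw => ?_) h₀ (sub_self _) τ hτ)
  simpa using (hf w hw).sub_const (f τ₀)

/-- A continuous square root of a differentiable function is differentiable where it does not
vanish. -/
theorem HasDerivAt.of_sq {f : ℂ → ℂ} {d τ : ℂ} (h : HasDerivAt (fun w => f w ^ 2) (2 * f τ * d) τ)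
    (hc : ContinuousAt f τ) (hf : f τ ≠ 0) : HasDerivAt f d τ := by
  rw [hasDerivAt_iff_tendsto_slope] at h ⊢
  have h1 : Filter.Tendsto (fun w => f w + f τ) (nhdsWithin τ {τ}ᶜ) (nhds (f τ + f τ)) :=
    (hc.add continuousAt_const).tendsto.mono_left nhdsWithin_le_nhds
  have h2 : f τ + f τ ≠ 0 := by simpa [← two_mul] using hf
  -- The difference quotient of `f²` is that of `f` times `f w + f τ`, and this factor tends to `2 f
  -- τ ≠ 0`.
  have h3 := h.div h1 h2
  have h4 : 2 * f τ * d / (f τ + f τ) = d := by field_simp; ring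
  rw [h4] at h3
  refine h3.congr' ?_
  filter_upwards [h1.eventually_ne h2] with w hw
  simp only [Pi.div_apply, slope_def_field]
  rw [div_eq_iff hw]
  ring

/-! ### Local uniqueness and the first integral of the canonical system. -/

namespace IsCanonicalSolution

variable {U V : Set ℂ} {x y z u x' y' z' u' : ℂ → ℂ}

theorem mono (h : IsCanonicalSolution U x y z u) (hV : V ⊆ U) : IsCanonicalSolution V x y z u :=
  ⟨fun τ hτ => h.1 τ (hV hτ), fun τ hτ => h.2 τ (hV hτ), fun τ hτ => h.3 τ (hV hτ),
    fun τ hτ => h.4 τ (hV hτ)⟩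

theorem continuousAt (h : IsCanonicalSolution U x y z u) {τ : ℂ} (hτ : τ ∈ U) :
    ContinuousAt x τ ∧ ContinuousAt y τ ∧ ContinuousAt z τ ∧ ContinuousAt u τ :=
  ⟨(h.1 τ hτ).continuousAt, (h.2 τ hτ).continuousAt, (h.3 τ hτ).continuousAt,
    (h.4 τ hτ).continuousAt⟩

theorem continuousOn (h : IsCanonicalSolution U x y z u) :
    ContinuousOn x U ∧ ContinuousOn y U ∧ ContinuousOn z U ∧ ContinuousOn u U :=
  ⟨fun _ hτ => (h.continuousAt hτ).1.continuousWithinAt,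
    fun _ hτ => (h.continuousAt hτ).2.1.continuousWithinAt,
    fun _ hτ => (h.continuousAt hτ).2.2.1.continuousWithinAt,
    fun _ hτ => (h.continuousAt hτ).2.2.2.continuousWithinAt⟩

/-- Local uniqueness for the canonical system. -/
theorem eventually_eq (h : IsCanonicalSolution U x y z u) (h' : IsCanonicalSolution U x' y' z' u')
    (hU : IsOpen U) {τ₀ : ℂ} (h₀ : τ₀ ∈ U) (hx : x τ₀ = x' τ₀) (hy : y τ₀ = y' τ₀)
    (hz : z τ₀ = z' τ₀) (hu : u τ₀ = u' τ₀) :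
    ∀ᶠ τ in nhds τ₀, x τ = x' τ ∧ y τ = y' τ ∧ z τ = z' τ ∧ u τ = u' τ := by
  let F : ℂ × ℂ × ℂ × ℂ → ℂ × ℂ × ℂ × ℂ := fun w =>
    ((w.2.2.2 + w.2.1 ^ 2 + w.2.2.1 ^ 2) * w.1,
     (w.2.2.2 + w.2.1 ^ 2 - 2 * w.2.2.1 ^ 2) * w.2.1,
     (w.2.2.2 - 2 * w.2.1 ^ 2 + w.2.2.1 ^ 2) * w.2.2.1,
     w.2.2.2 ^ 2 - w.2.1 ^ 4 + w.2.1 ^ 2 * w.2.2.1 ^ 2 - w.2.2.1 ^ 4)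
  have hF : ContDiff ℂ 1 F := by fun_prop
  let W : ℂ → ℂ × ℂ × ℂ × ℂ := fun τ => (x τ, y τ, z τ, u τ)
  let W' : ℂ → ℂ × ℂ × ℂ × ℂ := fun τ => (x' τ, y' τ, z' τ, u' τ)
  have hW : ∀ τ ∈ U, HasDerivAt W (F (W τ)) τ := fun τ hτ =>
    (h.1 τ hτ).prodMk ((h.2 τ hτ).prodMk ((h.3 τ hτ).prodMk (h.4 τ hτ)))
  have hW' : ∀ τ ∈ U, HasDerivAt W' (F (W' τ)) τ := fun τ hτ =>
    (h'.1 τ hτ).prodMk ((h'.2 τ hτ).prodMk ((h'.3 τ hτ).prodMk (h'.4 τ hτ)))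
  have hWW : W τ₀ = W' τ₀ := by simp [W, W', hx, hy, hz, hu]
  -- The polynomial vector field is locally Lipschitz, so the difference of two solutions satisfies
  -- the Grönwall hypothesis near `τ₀`.
  obtain ⟨K, t, ht, hK⟩ := (hF.contDiffAt (x := W τ₀)).exists_lipschitzOnWith
  have e1 : ∀ᶠ τ in nhds τ₀, W τ ∈ t := (hW τ₀ h₀).continuousAt.eventually_mem ht
  have e2 : ∀ᶠ τ in nhds τ₀, W' τ ∈ t := (hW' τ₀ h₀).continuousAt.eventually_mem (hWW ▸ ht)
  obtain ⟨r, hr, hb⟩ := Metric.eventually_nhds_iff_ball.1 ((e1.and e2).and (hU.mem_nhds h₀))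
  have := eq_zero_of_norm_deriv_le (f := fun τ => W τ - W' τ) (K := K)
    (f' := fun τ => F (W τ) - F (W' τ)) (fun w hw => (hW w (hb w hw).2).sub (hW' w (hb w hw).2))
    (fun w hw => hK.norm_sub_le (hb w hw).1.1 (hb w hw).1.2) (sub_eq_zero.2 hWW)
  filter_upwards [Metric.ball_mem_nhds τ₀ hr] with τ hτ
  have h2 := sub_eq_zero.1 (this τ hτ)
  simpa [W, W'] using h2

/-- The coefficient is twice the one in the equation for `x`. Hence `(y² - z²) / x²` is constant,
and `y² - z²` is zero-free once it is nonzero at a point. -/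
theorem hasDerivAt_sq_sub_sq (h : IsCanonicalSolution U x y z u) {τ : ℂ} (hτ : τ ∈ U) :
    HasDerivAt (fun w => y w ^ 2 - z w ^ 2)
      (2 * (u τ + y τ ^ 2 + z τ ^ 2) * (y τ ^ 2 - z τ ^ 2)) τ := by
  refine (((h.2 τ hτ).pow 2).sub ((h.3 τ hτ).pow 2)).congr_deriv ?_
  push_cast
  ring

theorem x_ne_zero (h : IsCanonicalSolution U x y z u) (hU : IsOpen U) (hc : IsPreconnected U)
    {τ₀ : ℂ} (h₀ : τ₀ ∈ U) (hx : x τ₀ ≠ 0) : ∀ τ ∈ U, x τ ≠ 0 := by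
  obtain ⟨-, cy, cz, cu⟩ := h.continuousOn
  exact ne_zero_of_linear hU hc (by fun_prop) h.1 h₀ hx

theorem y_ne_zero (h : IsCanonicalSolution U x y z u) (hU : IsOpen U) (hc : IsPreconnected U)
    {τ₀ : ℂ} (h₀ : τ₀ ∈ U) (hy : y τ₀ ≠ 0) : ∀ τ ∈ U, y τ ≠ 0 := by
  obtain ⟨-, cy, cz, cu⟩ := h.continuousOn
  exact ne_zero_of_linear hU hc (by fun_prop) h.2 h₀ hy

theorem sq_sub_sq_ne_zero (h : IsCanonicalSolution U x y z u) (hU : IsOpen U)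
    (hc : IsPreconnected U) {τ₀ : ℂ} (h₀ : τ₀ ∈ U) (hyz : y τ₀ ^ 2 - z τ₀ ^ 2 ≠ 0) :
    ∀ τ ∈ U, y τ ^ 2 - z τ ^ 2 ≠ 0 := by
  obtain ⟨-, cy, cz, cu⟩ := h.continuousOn
  exact ne_zero_of_linear (p := fun τ => 2 * (u τ + y τ ^ 2 + z τ ^ 2)) hU hc (by fun_prop)
    (fun τ hτ => h.hasDerivAt_sq_sub_sq hτ) h₀ hyz

/-- On solutions of the canonical system `(y² - z²) / (π x²)` is a nonzero constant. -/
theorem exists_onLevel (h : IsCanonicalSolution U x y z u) (hU : IsOpen U)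
    (hc : IsPreconnected U) {τ₀ : ℂ} (h₀ : τ₀ ∈ U) (hx : x τ₀ ≠ 0) (hy : y τ₀ ≠ 0)
    (hyz : y τ₀ ^ 2 ≠ z τ₀ ^ 2) : ∃ κ : ℂ, ∀ τ ∈ U, OnLevel κ (x τ) (y τ) (z τ) := by
  have hx' := h.x_ne_zero hU hc h₀ hx
  have hy' := h.y_ne_zero hU hc h₀ hy
  have hyz' := h.sq_sub_sq_ne_zero hU hc h₀ (sub_ne_zero.2 hyz)
  have hconst := eqOn_of_hasDerivAt_zero (f := fun τ => (y τ ^ 2 - z τ ^ 2) / x τ ^ 2) hU hc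
    (fun τ hτ => by
      refine ((h.hasDerivAt_sq_sub_sq hτ).div ((h.1 τ hτ).pow 2)
        (pow_ne_zero 2 (hx' τ hτ))).congr_deriv ?_
      rw [div_eq_zero_iff]
      left
      push_cast
      simp only [Pi.pow_apply]
      ring) h₀
  have hpi : (Real.pi : ℂ) ≠ 0 := by exact_mod_cast Real.pi_ne_zero
  obtain ⟨κ, hκ⟩ := IsAlgClosed.exists_pow_nat_eq
    ((y τ₀ ^ 2 - z τ₀ ^ 2) / x τ₀ ^ 2 / Real.pi) two_pos
  refine ⟨κ, fun τ hτ => ⟨?_, hx' τ hτ, hy' τ hτ, ?_⟩⟩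
  · rintro rfl
    have : (y τ₀ ^ 2 - z τ₀ ^ 2) / x τ₀ ^ 2 / Real.pi ≠ 0 :=
      div_ne_zero (div_ne_zero (hyz' τ₀ h₀) (pow_ne_zero 2 hx)) hpi
    exact this (by simpa using hκ.symm)
  · rw [hκ, mul_div_cancel₀ _ hpi]
    exact (hconst τ hτ).symm

end IsCanonicalSolution

/-! ### The point transformation. -/

theorem OnLevel.sq_sub_sq {κ x y z : ℂ} (h : OnLevel κ x y z) :
    y ^ 2 - z ^ 2 = Real.pi * κ ^ 2 * x ^ 2 := by
  rw [h.level, div_mul_cancel₀ _ (pow_ne_zero 2 h.x_ne)]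

theorem OnLevel.sq_sub_sq_ne_zero {κ x y z : ℂ} (h : OnLevel κ x y z) : y ^ 2 - z ^ 2 ≠ 0 := by
  have hpi : (Real.pi : ℂ) ≠ 0 := by exact_mod_cast Real.pi_ne_zero
  rw [h.sq_sub_sq]
  exact mul_ne_zero (mul_ne_zero hpi (pow_ne_zero 2 h.κ_ne)) (pow_ne_zero 2 h.x_ne)

/-- The point transformation with its denominators cleared. -/
theorem pointRelated_iff {κ x y z u A B a b : ℂ} (h : OnLevel κ x y z) :
    PointRelated κ x y z u A B a b ↔ y = (1 + I) * κ * A ∧ u = 2 * A * B - y ^ 2 + 2 * z ^ 2 ∧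
      a * A ^ 2 = -6 * (y ^ 2 - 2 * z ^ 2) ∧ 2 * b * A ^ 4 = 9 * z ^ 2 * (y ^ 2 - z ^ 2) := by
  have hpi : (Real.pi : ℂ) ≠ 0 := by exact_mod_cast Real.pi_ne_zero
  have hκ := h.κ_ne
  have hx := h.x_ne
  have hy := h.y_ne
  have hI : I ^ 2 = -1 := I_sq
  have hd := h.sq_sub_sq
  have e1 : A = (1 - I) / (2 * κ) * y ↔ y = (1 + I) * κ * A := by
    constructor
    · rintro rfl
      field_simp
      linear_combination hI
    · intro hy'
      rw [hy']
      field_simp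
      linear_combination A * hI
  by_cases hA : y = (1 + I) * κ * A
  swap
  · exact ⟨fun hp => absurd (e1.1 hp.A_eq) hA, fun hp => absurd hp.1 hA⟩
  have hA0 : A ≠ 0 := by
    rintro rfl
    exact hy (by simpa using hA)
  -- From `(1 + i)² = 2i`; the fourth power then brings in `(2i)² = -4`, which explains the sign in
  -- `b`.
  have hy2 : y ^ 2 = 2 * I * κ ^ 2 * A ^ 2 := by rw [hA]; linear_combination κ ^ 2 * A ^ 2 * hI
  have hy4 : y ^ 4 = -4 * κ ^ 4 * A ^ 4 := by
    linear_combination (y ^ 2 + 2 * I * κ ^ 2 * A ^ 2) * hy2 + 4 * κ ^ 4 * A ^ 4 * hI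
  have e2 : B = (1 + I) / 2 * (κ / y) * (u + y ^ 2 - 2 * z ^ 2) ↔
      u = 2 * A * B - y ^ 2 + 2 * z ^ 2 := by
    have : (1 + I) / 2 * (κ / y) = 1 / (2 * A) := by
      have : (1 + I) * κ ≠ 0 := fun h0 => hy (by rw [hA, h0, zero_mul])
      have : (1 + I : ℂ) ≠ 0 := left_ne_zero_of_mul this
      rw [hA]
      field_simp
    rw [this, one_div, eq_inv_mul_iff_mul_eq₀ (by simpa using hA0)]
    constructor <;> intro h1 <;> linear_combination -h1
  have e3 : a = 12 / (Real.pi * I) * ((y ^ 2 - z ^ 2) / x ^ 2) * ((y ^ 2 - 2 * z ^ 2) / y ^ 2) ↔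
      a * A ^ 2 = -6 * (y ^ 2 - 2 * z ^ 2) := by
    have : 12 / (Real.pi * I) * ((y ^ 2 - z ^ 2) / x ^ 2) * ((y ^ 2 - 2 * z ^ 2) / y ^ 2) =
        -6 * (y ^ 2 - 2 * z ^ 2) / A ^ 2 := by
      rw [hd, hy2]
      field_simp [I_ne_zero]
      linear_combination (6 : ℂ) * (2 * I * κ ^ 2 * A ^ 2 - 2 * z ^ 2) * hI
    rw [this, eq_div_iff (pow_ne_zero 2 hA0)]
  have e4 : b = -(18 / (Real.pi : ℂ) ^ 2) * (z ^ 2 / (x ^ 4 * y ^ 4)) * (y ^ 2 - z ^ 2) ^ 3 ↔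
      2 * b * A ^ 4 = 9 * z ^ 2 * (y ^ 2 - z ^ 2) := by
    have : -(18 / (Real.pi : ℂ) ^ 2) * (z ^ 2 / (x ^ 4 * y ^ 4)) * (y ^ 2 - z ^ 2) ^ 3 =
        9 * z ^ 2 * (y ^ 2 - z ^ 2) / (2 * A ^ 4) := by
      rw [hd, hy4]
      field_simp
      ring
    rw [this, eq_div_iff (by simpa using hA0)]
    constructor <;> intro h1 <;> linear_combination h1
  constructor
  · intro hp
    exact ⟨hA, e2.1 hp.B_eq, e3.1 hp.a_eq, e4.1 hp.b_eq⟩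
  · rintro ⟨-, h2, h3, h4⟩
    exact ⟨h, e1.2 hA, e2.2 h2, e3.2 h3, e4.2 h4⟩

theorem PointRelated.A_ne_zero {κ x y z u A B a b : ℂ} (h : PointRelated κ x y z u A B a b) :
    A ≠ 0 := by
  rintro rfl
  exact h.y_ne (by simpa using ((pointRelated_iff h.toOnLevel).1 h).1)

/-- The left side is a first integral of Jacobi's system; its value determines `κ` up to a fourth
root of unity. -/
theorem PointRelated.sq_add {κ x y z u A B a b : ℂ} (h : PointRelated κ x y z u A B a b) :
    a ^ 2 + 32 * b = -144 * κ ^ 4 := by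
  obtain ⟨h1, -, h3, h4⟩ := (pointRelated_iff h.toOnLevel).1 h
  have hA := h.A_ne_zero
  have hI : I ^ 2 = -1 := I_sq
  have hy2 : y ^ 2 = 2 * I * κ ^ 2 * A ^ 2 := by rw [h1]; linear_combination κ ^ 2 * A ^ 2 * hI
  have : A ^ 4 * (a ^ 2 + 32 * b) = A ^ 4 * (-144 * κ ^ 4) := by
    linear_combination (a * A ^ 2 - 6 * (y ^ 2 - 2 * z ^ 2)) * h3 + 16 * h4 +
      36 * (y ^ 2 + 2 * I * κ ^ 2 * A ^ 2) * hy2 + 144 * κ ^ 4 * A ^ 4 * hI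
  exact mul_left_cancel₀ (pow_ne_zero 4 hA) this

theorem exists_pointRelated_iff (A B a b : ℂ) :
    (∃ κ x y z u : ℂ, PointRelated κ x y z u A B a b) ↔ A ≠ 0 ∧ a ^ 2 + 32 * b ≠ 0 := by
  have hpi : (Real.pi : ℂ) ≠ 0 := by exact_mod_cast Real.pi_ne_zero
  have hI : I ^ 2 = -1 := I_sq
  constructor
  · rintro ⟨κ, x, y, z, u, h⟩
    refine ⟨h.A_ne_zero, ?_⟩
    rw [h.sq_add]
    exact mul_ne_zero (by norm_num) (pow_ne_zero 4 h.κ_ne)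
  · rintro ⟨hA, hab⟩
    -- The condition `a ≠ 12iκ²` amounts to `y² ≠ z²`, that is, to `x ≠ 0`. If one fourth root
    -- violates it, `iκ` reverses the sign of `κ²`; both violate it only when `κ = 0`.
    have key : ∃ κ : ℂ, κ ^ 4 = -(a ^ 2 + 32 * b) / 144 ∧ a ≠ 12 * I * κ ^ 2 := by
      obtain ⟨κ, hκ⟩ := IsAlgClosed.exists_pow_nat_eq (-(a ^ 2 + 32 * b) / 144) (n := 4)
        (by norm_num)
      by_cases h : a = 12 * I * κ ^ 2
      · refine ⟨I * κ, by rw [mul_pow, I_pow_four, one_mul, hκ], fun h' => hab ?_⟩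
        have hκ0 : κ ^ 2 = 0 := by
          have : (24 * I) * κ ^ 2 = 0 := by
            linear_combination h' - h + 12 * I * κ ^ 2 * hI
          simpa using this
        linear_combination (144 : ℂ) * hκ - 144 * κ ^ 2 * hκ0
      · exact ⟨κ, hκ, h⟩
    obtain ⟨κ, hκ4, hne⟩ := key
    have hκ : κ ≠ 0 := by
      rintro rfl
      apply hab
      linear_combination (144 : ℂ) * hκ4
    set y := (1 + I) * κ * A with hy
    have h1I : (1 + I : ℂ) ≠ 0 := by
      intro h
      simpa using congrArg Complex.re h
    have hy0 : y ≠ 0 := mul_ne_zero (mul_ne_zero h1I hκ) hA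
    have hy2 : y ^ 2 = 2 * I * κ ^ 2 * A ^ 2 := by rw [hy]; linear_combination κ ^ 2 * A ^ 2 * hI
    obtain ⟨z, hz⟩ := IsAlgClosed.exists_pow_nat_eq (y ^ 2 / 2 + a * A ^ 2 / 12) two_pos
    obtain ⟨x, hx⟩ := IsAlgClosed.exists_pow_nat_eq ((y ^ 2 - z ^ 2) / (Real.pi * κ ^ 2)) two_pos
    have hd : y ^ 2 - z ^ 2 = Real.pi * κ ^ 2 * x ^ 2 := by
      rw [hx]
      field_simp
    have hx0 : x ≠ 0 := by
      rintro rfl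
      apply hne
      have : A ^ 2 * a = A ^ 2 * (12 * I * κ ^ 2) := by
        linear_combination (-12 : ℂ) * hd - 12 * hz + 6 * hy2
      exact mul_left_cancel₀ (pow_ne_zero 2 hA) this
    have hL : OnLevel κ x y z := ⟨hκ, hx0, hy0, by rw [hd]; field_simp⟩
    refine ⟨κ, x, y, z, 2 * A * B - y ^ 2 + 2 * z ^ 2,
      (pointRelated_iff hL).2 ⟨hy, rfl, by linear_combination (-12 : ℂ) * hz, ?_⟩⟩
    rw [hz]
    linear_combination (-9 / 4 : ℂ) * (y ^ 2 + 2 * I * κ ^ 2 * A ^ 2) * hy2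
      + 9 * A ^ 4 * hκ4 - 9 * κ ^ 4 * A ^ 4 * hI

/-- The point transformation takes solutions of the canonical system to solutions of Jacobi's. -/
theorem IsCanonicalSolution.isJacobiSolution {U : Set ℂ} {κ : ℂ} {x y z u A B a b : ℂ → ℂ}
    (hU : IsOpen U)
    (hr : ∀ τ ∈ U, PointRelated κ (x τ) (y τ) (z τ) (u τ) (A τ) (B τ) (a τ) (b τ))
    (h : IsCanonicalSolution U x y z u) : IsJacobiSolution U A B a b := by
  have key := fun τ hτ => (pointRelated_iff (hr τ hτ).toOnLevel).1 (hr τ hτ)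
  have hA0 := fun τ hτ => (hr τ hτ).A_ne_zero
  have hA : ∀ τ ∈ U, HasDerivAt A (2 * A τ ^ 2 * B τ) τ := by
    intro τ hτ
    obtain ⟨h1, h2, h3, h4⟩ := key τ hτ
    refine (((h.2 τ hτ).const_mul ((1 - I) / (2 * κ))).congr_of_eventuallyEq ?_).congr_deriv ?_
    · filter_upwards [hU.mem_nhds hτ] with w hw using (hr w hw).A_eq
    · rw [mul_left_comm, ← (hr τ hτ).A_eq, h2]
      ring
  refine ⟨hA, fun τ hτ => ?_, fun τ hτ => ?_, fun τ hτ => ?_⟩ <;>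
    obtain ⟨h1, h2, h3, h4⟩ := key τ hτ
  -- Here `B` is written as `(u + y² - 2z²) / (2A)`; `a` and `b` are likewise differentiated as
  -- quotients by powers of `A`.
  · have : HasDerivAt B ((u τ ^ 2 - y τ ^ 4 + y τ ^ 2 * z τ ^ 2 - z τ ^ 4 +
        2 * y τ * ((u τ + y τ ^ 2 - 2 * z τ ^ 2) * y τ) -
        2 * (2 * z τ * ((u τ - 2 * y τ ^ 2 + z τ ^ 2) * z τ)) - 2 * (2 * A τ ^ 2 * B τ) * B τ) /
          (2 * A τ)) τ := by
      have hv := (((h.4 τ hτ).add ((h.2 τ hτ).pow 2)).sub (((h.3 τ hτ).pow 2).const_mul 2)).div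
        ((hA τ hτ).const_mul 2) (mul_ne_zero two_ne_zero (hA0 τ hτ))
      refine (hv.congr_of_eventuallyEq ?_).congr_deriv ?_
      · filter_upwards [hU.mem_nhds hτ] with w hw
        have := hA0 w hw
        have h2 := (key w hw).2.1
        simp only [Pi.div_apply, Pi.sub_apply, Pi.add_apply, Pi.pow_apply]
        rw [eq_div_iff (by simpa using this)]
        linear_combination -h2
      · have := hA0 τ hτ
        simp only [Pi.sub_apply, Pi.add_apply, Pi.pow_apply]
        field_simp
        rw [h2]
        push_cast
        ring
    refine this.congr_deriv ?_
    rw [div_eq_iff (mul_ne_zero two_ne_zero (hA0 τ hτ)), h2]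
    linear_combination -h4
  · have hv := ((((h.2 τ hτ).pow 2).sub (((h.3 τ hτ).pow 2).const_mul 2)).const_mul (-6)).div
        ((hA τ hτ).pow 2) (pow_ne_zero 2 (hA0 τ hτ))
    refine (hv.congr_of_eventuallyEq ?_).congr_deriv ?_
    · filter_upwards [hU.mem_nhds hτ] with w hw
      have := hA0 w hw
      simp only [Pi.div_apply, Pi.sub_apply, Pi.pow_apply]
      rw [eq_div_iff (pow_ne_zero 2 this)]
      exact (key w hw).2.2.1
    · have := hA0 τ hτ
      simp only [Pi.sub_apply, Pi.pow_apply]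
      rw [h2, div_eq_iff (pow_ne_zero 2 (pow_ne_zero 2 this))]
      push_cast
      linear_combination 8 * A τ ^ 2 * h4
  · have hv := ((((h.3 τ hτ).pow 2).const_mul 9).mul (h.hasDerivAt_sq_sub_sq hτ)).div
        (((hA τ hτ).pow 4).const_mul 2) (mul_ne_zero two_ne_zero (pow_ne_zero 4 (hA0 τ hτ)))
    refine (hv.congr_of_eventuallyEq ?_).congr_deriv ?_
    · filter_upwards [hU.mem_nhds hτ] with w hw
      have := hA0 w hw
      simp only [Pi.div_apply, Pi.mul_apply, Pi.pow_apply]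
      rw [eq_div_iff (mul_ne_zero two_ne_zero (pow_ne_zero 4 this))]
      linear_combination (key w hw).2.2.2
    · have := hA0 τ hτ
      simp only [Pi.mul_apply, Pi.pow_apply]
      rw [h2, div_eq_iff (pow_ne_zero 2 (mul_ne_zero two_ne_zero (pow_ne_zero 4 this)))]
      push_cast
      linear_combination (-2 : ℂ) * A τ ^ 6 * a τ * h4 -
        18 * A τ ^ 4 * z τ ^ 2 * (y τ ^ 2 - z τ ^ 2) * h3

/-- The point transformation takes solutions of Jacobi's system to solutions of the canonical
one. -/
theorem IsJacobiSolution.isCanonicalSolution {U : Set ℂ} {κ : ℂ} {x y z u A B a b : ℂ → ℂ}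
    (hU : IsOpen U) (cx : ContinuousOn x U) (cz : ContinuousOn z U)
    (hr : ∀ τ ∈ U, PointRelated κ (x τ) (y τ) (z τ) (u τ) (A τ) (B τ) (a τ) (b τ))
    (h : IsJacobiSolution U A B a b) : IsCanonicalSolution U x y z u := by
  have key := fun τ hτ => (pointRelated_iff (hr τ hτ).toOnLevel).1 (hr τ hτ)
  have hpi : (Real.pi : ℂ) ≠ 0 := by exact_mod_cast Real.pi_ne_zero
  have hy : ∀ τ ∈ U, HasDerivAt y ((u τ + y τ ^ 2 - 2 * z τ ^ 2) * y τ) τ := by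
    intro τ hτ
    obtain ⟨h1, h2, h3, h4⟩ := key τ hτ
    refine (((h.1 τ hτ).const_mul ((1 + I) * κ)).congr_of_eventuallyEq ?_).congr_deriv ?_
    · filter_upwards [hU.mem_nhds hτ] with w hw using (key w hw).1
    · rw [h2, h1]
      ring
  -- The cleared equation for `a` expresses `z²` as `y²/2 + aA²/12`, which is differentiable without
  -- any knowledge of `z`.
  have hz2 : ∀ τ ∈ U, HasDerivAt (fun w => z w ^ 2)
      (2 * z τ * ((u τ - 2 * y τ ^ 2 + z τ ^ 2) * z τ)) τ := by
    intro τ hτ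
    obtain ⟨h1, h2, h3, h4⟩ := key τ hτ
    have hv := (((hy τ hτ).pow 2).const_mul (1 / 2)).add
      (((h.3 τ hτ).mul ((h.1 τ hτ).pow 2)).const_mul (1 / 12))
    refine (hv.congr_of_eventuallyEq ?_).congr_deriv ?_
    · filter_upwards [hU.mem_nhds hτ] with w hw
      simp only [Pi.add_apply, Pi.mul_apply, Pi.pow_apply]
      linear_combination (-1 / 12 : ℂ) * (key w hw).2.2.1
    · simp only [Pi.pow_apply]
      rw [h2]
      push_cast
      linear_combination (-2 / 3 : ℂ) * h4 + (1 / 3 : ℂ) * A τ * B τ * h3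
  have hz : ∀ τ ∈ U, HasDerivAt z ((u τ - 2 * y τ ^ 2 + z τ ^ 2) * z τ) τ := by
    intro τ hτ
    have hcz := cz.continuousAt (hU.mem_nhds hτ)
    -- At a zero of `z` its derivative cannot be read off from `z²`. But there `b = 0`, so the
    -- linear equation for `b` gives `b = 0` on a disc, and then `z = 0` on it since `y² ≠ z²`.
    by_cases h0 : z τ = 0
    · obtain ⟨r, hrp, hb⟩ := Metric.isOpen_iff.1 hU τ hτ
      have hAc : ContinuousOn A U := fun w hw => (h.1 w hw).continuousAt.continuousWithinAt
      have hac : ContinuousOn a U := fun w hw => (h.3 w hw).continuousAt.continuousWithinAt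
      have hb0 : b τ = 0 := by
        have := (key τ hτ).2.2.2
        have hA := (hr τ hτ).A_ne_zero
        simpa [h0, hA] using this
      have hbz := eqOn_zero_of_linear (f := b) (p := fun w => a w * A w ^ 2) Metric.isOpen_ball
        (convex_ball τ r).isPreconnected ((hac.mul (hAc.pow 2)).mono hb)
        (fun w hw => (h.4 w (hb hw)).congr_deriv (by ring)) (Metric.mem_ball_self hrp) hb0
      rw [h0, mul_zero]
      refine (hasDerivAt_const τ (0 : ℂ)).congr_of_eventuallyEq ?_
      filter_upwards [Metric.ball_mem_nhds τ hrp] with w hw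
      have := (key w (hb hw)).2.2.2
      have hd := (hr w (hb hw)).sq_sub_sq_ne_zero
      simpa [hbz w hw, hd] using this
    · exact (hz2 τ hτ).of_sq hcz h0
  have hx : ∀ τ ∈ U, HasDerivAt x ((u τ + y τ ^ 2 + z τ ^ 2) * x τ) τ := by
    intro τ hτ
    have hκ := (hr τ hτ).κ_ne
    have hv := (((hy τ hτ).pow 2).sub (hz2 τ hτ)).div_const (Real.pi * κ ^ 2)
    have hd := (hr τ hτ).sq_sub_sq
    refine HasDerivAt.of_sq ((hv.congr_of_eventuallyEq ?_).congr_deriv ?_)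
      (cx.continuousAt (hU.mem_nhds hτ)) (hr τ hτ).x_ne
    · filter_upwards [hU.mem_nhds hτ] with w hw
      have := (hr w hw).sq_sub_sq
      simp only [Pi.sub_apply, Pi.pow_apply]
      rw [this]
      field_simp
    · rw [div_eq_iff (mul_ne_zero hpi (pow_ne_zero 2 hκ))]
      push_cast
      linear_combination 2 * (u τ + y τ ^ 2 + z τ ^ 2) * hd
  refine ⟨hx, hy, hz, fun τ hτ => ?_⟩
  obtain ⟨h1, h2, h3, h4⟩ := key τ hτ
  have hv := (((((h.1 τ hτ).const_mul 2).mul (h.2 τ hτ))).sub ((hy τ hτ).pow 2)).add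
    ((hz2 τ hτ).const_mul 2)
  refine (hv.congr_of_eventuallyEq ?_).congr_deriv ?_
  · filter_upwards [hU.mem_nhds hτ] with w hw
    simp only [Pi.add_apply, Pi.mul_apply, Pi.sub_apply, Pi.pow_apply]
    linear_combination (key w hw).2.1
  · rw [h2]
    push_cast
    linear_combination h4

/-- Every solution of Jacobi's system in the image of the point transformation is the image of a
solution of the canonical system. -/
theorem IsJacobiSolution.exists_isCanonicalSolution {U : Set ℂ} {A B a b : ℂ → ℂ}
    {τ₀ κ x₀ y₀ z₀ u₀ : ℂ} (hU : IsOpen U) (hs : IsSimplyConnected U) (h₀ : τ₀ ∈ U)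
    (h : IsJacobiSolution U A B a b)
    (hp : PointRelated κ x₀ y₀ z₀ u₀ (A τ₀) (B τ₀) (a τ₀) (b τ₀)) :
    ∃ x y z u : ℂ → ℂ, x τ₀ = x₀ ∧ y τ₀ = y₀ ∧ z τ₀ = z₀ ∧ u τ₀ = u₀ ∧
      IsCanonicalSolution U x y z u ∧
      ∀ τ ∈ U, PointRelated κ (x τ) (y τ) (z τ) (u τ) (A τ) (B τ) (a τ) (b τ) := by
  have hI : I ^ 2 = -1 := I_sq
  have hpi : (Real.pi : ℂ) ≠ 0 := by exact_mod_cast Real.pi_ne_zero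
  have hc : IsPreconnected U := hs.isPathConnected.isConnected.isPreconnected
  have hκ := hp.κ_ne
  obtain ⟨p1, p2, p3, p4⟩ := (pointRelated_iff hp.toOnLevel).1 hp
  have cA : ContinuousOn A U := fun w hw => (h.1 w hw).continuousAt.continuousWithinAt
  have cB : ContinuousOn B U := fun w hw => (h.2 w hw).continuousAt.continuousWithinAt
  have ca : ContinuousOn a U := fun w hw => (h.3 w hw).continuousAt.continuousWithinAt
  have hA : ∀ τ ∈ U, A τ ≠ 0 := ne_zero_of_linear (p := fun τ => 2 * A τ * B τ) hU hc
    (by fun_prop) (fun τ hτ => (h.1 τ hτ).congr_deriv (by ring)) h₀ hp.A_ne_zero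
  have hab : ∀ τ ∈ U, a τ ^ 2 + 32 * b τ = -144 * κ ^ 4 := by
    intro τ hτ
    rw [← hp.sq_add]
    refine eqOn_of_hasDerivAt_zero (f := fun τ => a τ ^ 2 + 32 * b τ) hU hc
      (fun τ hτ => (((h.3 τ hτ).pow 2).add ((h.4 τ hτ).const_mul 32)).congr_deriv ?_) h₀ τ hτ
    push_cast
    ring
  set y : ℂ → ℂ := fun τ => (1 + I) * κ * A τ with hy
  -- `Z` is the future `z²`, and `(y² - Z) / (πκ²)` the future `x²`. Both `Z` and `y² - Z` satisfy
  -- linear equations.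
  set Z : ℂ → ℂ := fun τ => y τ ^ 2 / 2 + a τ * A τ ^ 2 / 12 with hZ
  have cy : ContinuousOn y U := by fun_prop
  have cZ : ContinuousOn Z U := by fun_prop
  have hy2 : ∀ τ, y τ ^ 2 = 2 * I * κ ^ 2 * A τ ^ 2 := fun τ => by
    simp only [hy]
    linear_combination κ ^ 2 * A τ ^ 2 * hI
  have hb : ∀ τ ∈ U, 2 * b τ * A τ ^ 4 = 9 * Z τ * (y τ ^ 2 - Z τ) := by
    intro τ hτ
    simp only [hZ]
    linear_combination (-9 / 4 : ℂ) * (y τ ^ 2 + 2 * I * κ ^ 2 * A τ ^ 2) * hy2 τ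
      + A τ ^ 4 / 16 * hab τ hτ - 9 * κ ^ 4 * A τ ^ 4 * hI
  have dy : ∀ τ ∈ U, HasDerivAt y (2 * A τ * B τ * y τ) τ := fun τ hτ =>
    ((h.1 τ hτ).const_mul ((1 + I) * κ)).congr_deriv (by simp only [hy]; ring)
  have dZ : ∀ τ ∈ U, HasDerivAt Z (2 * (2 * A τ * B τ - 3 * (y τ ^ 2 - Z τ)) * Z τ) τ := by
    intro τ hτ
    refine ((((dy τ hτ).pow 2).div_const 2).add
      (((h.3 τ hτ).mul ((h.1 τ hτ).pow 2)).div_const 12)).congr_deriv ?_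
    have := hb τ hτ
    simp only [Pi.pow_apply]
    push_cast
    have hZτ : Z τ = y τ ^ 2 / 2 + a τ * A τ ^ 2 / 12 := rfl
    linear_combination (-2 / 3 : ℂ) * this - 4 * A τ * B τ * hZτ
  have dyZ : ∀ τ ∈ U, HasDerivAt (fun w => y w ^ 2 - Z w)
      (2 * (2 * A τ * B τ + 3 * Z τ) * (y τ ^ 2 - Z τ)) τ := by
    intro τ hτ
    refine (((dy τ hτ).pow 2).sub (dZ τ hτ)).congr_deriv ?_
    push_cast
    ring
  have hZ0 : Z τ₀ = z₀ ^ 2 := by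
    simp only [hZ, hy, ← p1]
    linear_combination (1 / 12 : ℂ) * p3
  have hyZ0 : y τ₀ ^ 2 - Z τ₀ = Real.pi * κ ^ 2 * x₀ ^ 2 := by
    rw [hZ0, ← hp.sq_sub_sq]
    simp only [hy, ← p1]
  have hyZ : ∀ τ ∈ U, y τ ^ 2 - Z τ ≠ 0 :=
    ne_zero_of_linear (p := fun τ => 2 * (2 * A τ * B τ + 3 * Z τ)) hU hc (by fun_prop) dyZ h₀ (by
      rw [hyZ0]
      exact mul_ne_zero (mul_ne_zero hpi (pow_ne_zero 2 hκ)) (pow_ne_zero 2 hp.x_ne))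
  -- Simple connectedness supplies a continuous root of a zero-free function; the sign is adjusted
  -- to the prescribed value at `τ₀`.
  have root : ∀ (g : ℂ → ℂ) (r : ℂ), ContinuousOn g U → (∀ τ ∈ U, g τ ≠ 0) → g τ₀ = r ^ 2 →
      ∃ f : ℂ → ℂ, ContinuousOn f U ∧ f τ₀ = r ∧ ∀ τ ∈ U, f τ ^ 2 = g τ := by
    intro g r hg hg0 hr
    obtain ⟨f, hf, hfg⟩ := Complex.exists_continuousOn_pow_eq hs hU hg
      (by rintro ⟨τ, hτ, h0⟩; exact hg0 τ hτ h0) two_ne_zero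
    rcases sq_eq_sq_iff_eq_or_eq_neg.1 ((hfg τ₀).trans hr) with h1 | h1
    · exact ⟨f, hf, h1, fun τ _ => hfg τ⟩
    · exact ⟨fun τ => -f τ, hf.neg, by simp [h1], fun τ _ => by rw [neg_sq, hfg]⟩
  obtain ⟨x, cx, hx₀, hx⟩ := root (fun τ => (y τ ^ 2 - Z τ) / (Real.pi * κ ^ 2)) x₀ (by fun_prop)
    (fun τ hτ => div_ne_zero (hyZ τ hτ) (mul_ne_zero hpi (pow_ne_zero 2 hκ)))
    (by simp only [hyZ0]; field_simp)
  obtain ⟨z, cz, hz₀, hz⟩ : ∃ f : ℂ → ℂ, ContinuousOn f U ∧ f τ₀ = z₀ ∧ ∀ τ ∈ U, f τ ^ 2 = Z τ := by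
    -- By its linear equation `Z` either vanishes identically, with root `0`, or never.
    by_cases h0 : z₀ = 0
    · refine ⟨fun _ => 0, continuousOn_const, h0.symm, fun τ hτ => ?_⟩
      rw [eqOn_zero_of_linear (f := Z) (p := fun τ => 2 * (2 * A τ * B τ - 3 * (y τ ^ 2 - Z τ)))
        hU hc (by fun_prop) dZ h₀ (by simp [hZ0, h0]) τ hτ]
      simp
    · exact root Z z₀ cZ (ne_zero_of_linear
        (p := fun τ => 2 * (2 * A τ * B τ - 3 * (y τ ^ 2 - Z τ))) hU hc (by fun_prop) dZ h₀
        (by simpa [hZ0] using h0)) hZ0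
  have hrel : ∀ τ ∈ U, PointRelated κ (x τ) (y τ) (z τ) (2 * A τ * B τ - y τ ^ 2 + 2 * z τ ^ 2)
      (A τ) (B τ) (a τ) (b τ) := by
    intro τ hτ
    have hd : y τ ^ 2 - Z τ = Real.pi * κ ^ 2 * x τ ^ 2 := by
      rw [hx τ hτ]
      field_simp
    have hx0 : x τ ≠ 0 := by
      intro h0
      exact hyZ τ hτ (by simp [hd, h0])
    have hL : OnLevel κ (x τ) (y τ) (z τ) := by
      refine ⟨hκ, hx0, ?_, ?_⟩
      · intro h0
        have h1 : (1 + I) * κ * A τ = 0 := h0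
        have h1I : (1 + I : ℂ) ≠ 0 := fun h => by simpa using congrArg Complex.re h
        simp [h1I, hκ, hA τ hτ] at h1
      · rw [hz τ hτ, hd]
        field_simp
    refine (pointRelated_iff hL).2 ⟨rfl, rfl, ?_, ?_⟩
    · rw [hz τ hτ]
      simp only [hZ]
      ring
    · rw [hz τ hτ]
      exact hb τ hτ
  refine ⟨x, y, z, fun τ => 2 * A τ * B τ - y τ ^ 2 + 2 * z τ ^ 2, hx₀, p1.symm, hz₀, ?_,
    h.isCanonicalSolution hU cx cz hrel, hrel⟩
  simp only [hz₀, p2, hy, ← p1]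

/-! ### Propagation of agreement between two solutions. -/

theorem ContinuousAt.eq_of_mem_closure {f g : ℂ → ℂ} {s : Set ℂ} {τ : ℂ} (hf : ContinuousAt f τ)
    (hg : ContinuousAt g τ) (hτ : τ ∈ closure s) (h : ∀ w ∈ s, f w = g w) : f τ = g τ := by
  have : (nhdsWithin τ s).NeBot := mem_closure_iff_nhdsWithin_neBot.1 hτ
  refine tendsto_nhds_unique (l := nhdsWithin τ s) (hf.tendsto.mono_left nhdsWithin_le_nhds)
    ((hg.tendsto.mono_left nhdsWithin_le_nhds).congr' ?_)
  filter_upwards [self_mem_nhdsWithin] with w hw using (h w hw).symm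

/-- A solution on a connected set `U` which agrees at one point with a solution on `V` agrees with
it on all of `U`, provided that `U` does not leave `V` through limits of points of agreement. -/
theorem IsCanonicalSolution.eqOn_of_eq {U V : Set ℂ} {x y z u x' y' z' u' : ℂ → ℂ}
    (h : IsCanonicalSolution U x y z u) (h' : IsCanonicalSolution V x' y' z' u')
    (hU : IsOpen U) (hc : IsPreconnected U) (hV : IsOpen V) {τ₀ : ℂ} (h₀ : τ₀ ∈ U) (h₀' : τ₀ ∈ V)
    (hx : x τ₀ = x' τ₀) (hy : y τ₀ = y' τ₀) (hz : z τ₀ = z' τ₀) (hu : u τ₀ = u' τ₀)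
    (hcl : ∀ τ ∈ U, τ ∈ closure {w | (w ∈ U ∧ w ∈ V) ∧
      x w = x' w ∧ y w = y' w ∧ z w = z' w ∧ u w = u' w} → τ ∈ V) :
    ∀ τ ∈ U, τ ∈ V ∧ x τ = x' τ ∧ y τ = y' τ ∧ z τ = z' τ ∧ u τ = u' τ := by
  suffices U ⊆ {w | (w ∈ U ∧ w ∈ V) ∧ x w = x' w ∧ y w = y' w ∧ z w = z' w ∧ u w = u' w} from
    fun τ hτ => ⟨(this hτ).1.2, (this hτ).2⟩
  refine hc.subset_of_closure_inter_subset ?_ ⟨τ₀, h₀, ⟨h₀, h₀'⟩, hx, hy, hz, hu⟩ ?_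
  · rw [isOpen_iff_mem_nhds]
    rintro w ⟨⟨hw, hw'⟩, e1, e2, e3, e4⟩
    filter_upwards [(h.mono Set.inter_subset_left).eventually_eq (h'.mono Set.inter_subset_right)
      (hU.inter hV) ⟨hw, hw'⟩ e1 e2 e3 e4, hU.mem_nhds hw, hV.mem_nhds hw'] with v hv hv1 hv2
    exact ⟨⟨hv1, hv2⟩, hv⟩
  · rintro w ⟨hw, hwU⟩
    have hwV := hcl w hwU hw
    obtain ⟨c1, c2, c3, c4⟩ := h.continuousAt hwU
    obtain ⟨d1, d2, d3, d4⟩ := h'.continuousAt hwV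
    exact ⟨⟨hwU, hwV⟩, c1.eq_of_mem_closure d1 hw fun v hv => hv.2.1,
      c2.eq_of_mem_closure d2 hw fun v hv => hv.2.2.1,
      c3.eq_of_mem_closure d3 hw fun v hv => hv.2.2.2.1,
      c4.eq_of_mem_closure d4 hw fun v hv => hv.2.2.2.2⟩

/-! ### Elementary solutions. -/

theorem isCanonicalSolution_elementary {σ : ℂ} (γ δ : ℂ) (hσ : σ = 1 ∨ σ = -1) :
    IsCanonicalSolution {τ | γ * τ + δ ≠ 0} (fun _ => 0) (fun τ => σ / (γ * τ + δ))
      (fun τ => 1 / (γ * τ + δ)) (fun τ => -((γ ^ 2 * τ + γ * δ - 1) / (γ * τ + δ) ^ 2)) := by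
  have hσ2 : σ ^ 2 = 1 := by rcases hσ with rfl | rfl <;> norm_num
  have hσ4 : σ ^ 4 = 1 := by rcases hσ with rfl | rfl <;> norm_num
  have hl : ∀ τ : ℂ, HasDerivAt (fun τ => γ * τ + δ) γ τ := fun τ => by
    simpa using ((hasDerivAt_id τ).const_mul γ).add_const δ
  have hinv : ∀ (s τ : ℂ), γ * τ + δ ≠ 0 →
      HasDerivAt (fun τ => s / (γ * τ + δ)) (-(s * γ) / (γ * τ + δ) ^ 2) τ := fun s τ h =>
    ((hasDerivAt_const τ s).fun_div (hl τ) h).congr_deriv (by simp)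
  refine ⟨fun τ _ => ?_, fun τ hτ => ?_, fun τ hτ => ?_, fun τ hτ => ?_⟩
  · simpa using hasDerivAt_const τ (0 : ℂ)
  · have h0 : γ * τ + δ ≠ 0 := hτ
    refine (hinv σ τ hτ).congr_deriv ?_
    simp only [div_pow, hσ2]
    field_simp
    ring
  · have h0 : γ * τ + δ ≠ 0 := hτ
    refine (hinv 1 τ hτ).congr_deriv ?_
    simp only [div_pow, hσ2]
    field_simp
    ring
  · have h0 : γ * τ + δ ≠ 0 := hτ
    have h1 : HasDerivAt (fun τ => γ ^ 2 * τ + γ * δ - 1) (γ ^ 2) τ := by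
      simpa using (((hasDerivAt_id τ).const_mul (γ ^ 2)).add_const (γ * δ)).sub_const 1
    refine ((h1.div ((hl τ).pow 2) (pow_ne_zero 2 h0)).neg).congr_deriv ?_
    simp only [div_pow, hσ2, hσ4, Pi.pow_apply]
    field_simp
    push_cast
    ring

theorem IsCanonicalSolution.exists_elementary {U : Set ℂ} {x y z u : ℂ → ℂ} {τ₀ : ℂ}
    (h : IsCanonicalSolution U x y z u) (hU : IsOpen U) (hc : IsPreconnected U) (h₀ : τ₀ ∈ U)
    (hx : x τ₀ = 0) (hyz : y τ₀ ^ 2 = z τ₀ ^ 2) (hz : z τ₀ ≠ 0) :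
    ∃ σ γ δ : ℂ, (σ = 1 ∨ σ = -1) ∧ ∀ τ ∈ U, γ * τ + δ ≠ 0 ∧ x τ = 0 ∧
      y τ = σ / (γ * τ + δ) ∧ z τ = 1 / (γ * τ + δ) ∧
      u τ = -((γ ^ 2 * τ + γ * δ - 1) / (γ * τ + δ) ^ 2) := by
  obtain ⟨σ, hσ, hyσ⟩ : ∃ σ : ℂ, (σ = 1 ∨ σ = -1) ∧ y τ₀ = σ * z τ₀ := by
    rcases sq_eq_sq_iff_eq_or_eq_neg.1 hyz with h1 | h1
    · exact ⟨1, Or.inl rfl, by rw [h1, one_mul]⟩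
    · exact ⟨-1, Or.inr rfl, by rw [h1, neg_one_mul]⟩
  -- The elementary family satisfies `u = z² - γz`, which determines `γ`; then `z(γτ + δ) = 1` at
  -- `τ₀` determines `δ`.
  obtain ⟨γ, hγ⟩ : ∃ γ, γ = (z τ₀ ^ 2 - u τ₀) / z τ₀ := ⟨_, rfl⟩
  obtain ⟨δ, hδ⟩ : ∃ δ, δ = 1 / z τ₀ - γ * τ₀ := ⟨_, rfl⟩
  have e0 : γ * τ₀ + δ = 1 / z τ₀ := by rw [hδ]; ring
  have hne : γ * τ₀ + δ ≠ 0 := by rw [e0]; exact one_div_ne_zero hz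
  have hV : IsOpen {τ : ℂ | γ * τ + δ ≠ 0} := isOpen_ne_fun (by fun_prop) (by fun_prop)
  refine ⟨σ, γ, δ, hσ, h.eqOn_of_eq (isCanonicalSolution_elementary γ δ hσ) hU hc hV h₀ hne hx
    ?_ ?_ ?_ ?_⟩
  · rw [e0, hyσ]
    simp
  · rw [e0]
    simp
  · have e1 : γ ^ 2 * τ₀ + γ * δ - 1 = γ * (1 / z τ₀) - 1 := by rw [← e0]; ring
    rw [e0, e1, hγ]
    field_simp
    ring
  -- The relation `z(γτ + δ) = 1` passes to limits of points of agreement, so `γτ + δ` has no zero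
  -- there.
  · intro τ hτ hcl h0
    have hz' := (h.continuousAt hτ).2.2.1
    have : z τ * (γ * τ + δ) = 1 := by
      refine ContinuousAt.eq_of_mem_closure (f := fun w => z w * (γ * w + δ)) (by fun_prop) continuousAt_const hcl ?_
      rintro w ⟨⟨-, hw : γ * w + δ ≠ 0⟩, -, -, h3, -⟩
      simp only [h3]
      exact one_div_mul_cancel hw
    simp [h0] at this

/-! ### Cusp forms of level one. -/

open UpperHalfPlane ModularForm MatrixGroups in
/-- A holomorphic function on the upper half-plane with the transformation behaviour of a level one
form of weight `k` which tends to zero at `i∞` is a cusp form. -/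
theorem exists_cuspForm {F : ℂ → ℂ} {k : ℤ} (hd : ∀ τ : ℂ, 0 < τ.im → DifferentiableAt ℂ F τ)
    (hT : ∀ τ : ℂ, 0 < τ.im → F (τ + 1) = F τ)
    (hS : ∀ τ : ℂ, 0 < τ.im → F (-1 / τ) = τ ^ k * F τ)
    (h0 : Filter.Tendsto F (Filter.comap Complex.im Filter.atTop) (nhds 0)) :
    ∃ f : CuspForm 𝒮ℒ k, ∀ τ : ℍ, f τ = F τ := by
  have slS : (fun τ : ℍ => F τ) ∣[k] ModularGroup.S = fun τ : ℍ => F τ := by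
    ext τ
    have hτ : (τ : ℂ) ≠ 0 := τ.ne_zero
    rw [ModularForm.SL_slash_apply, UpperHalfPlane.modular_S_smul, ModularGroup.denom_S]
    have h1 : F (-1 / τ) = (τ : ℂ) ^ k * F τ := hS τ τ.2
    rw [UpperHalfPlane.coe_mk, inv_neg, ← one_div, ← neg_div, h1, zpow_neg]
    field_simp
  have slT : (fun τ : ℍ => F τ) ∣[k] ModularGroup.T = fun τ : ℍ => F τ := by
    ext τ
    have hden : denom ModularGroup.T τ = 1 := by
      rw [ModularGroup.denom_apply]
      simp [ModularGroup.T]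
    have h1 := hT τ τ.2
    rw [ModularForm.SL_slash_apply, UpperHalfPlane.modular_T_smul, hden]
    simp [add_comm, h1]
  have sl := SlashInvariantForm.slash_action_generators_SL2Z slS slT
  refine ⟨{ toFun := fun τ => F τ, slash_action_eq' := ?_, holo' := ?_, zero_at_cusps' := ?_ },
    fun _ => rfl⟩
  · rintro A ⟨A, rfl⟩
    exact sl A
  · rw [UpperHalfPlane.mdifferentiable_iff]
    refine DifferentiableOn.congr (fun z hz => (hd z hz).differentiableWithinAt) fun z hz => ?_
    simp [ofComplex_apply_of_im_pos hz]
  -- Every cusp is `SL(2, ℤ)`-equivalent to `i∞`, and slash invariance reduces the condition there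
  -- to the limit `h0`.
  · intro c hc
    rw [Subgroup.IsArithmetic.isCusp_iff_isCusp_SL2Z] at hc
    rw [OnePoint.isZeroAt_iff_forall_SL2Z hc]
    intro γ _
    change IsZeroAtImInfty ((fun τ : ℍ => F τ) ∣[k] γ)
    rw [sl γ]
    exact h0.comp tendsto_coe_atImInfty

open UpperHalfPlane ModularForm MatrixGroups in
-- The main source of identities below: it suffices to check both generators and the limit at `i∞`.
theorem eq_zero_of_weight_lt_twelve {F : ℂ → ℂ} {k : ℕ} (hk : k < 12)
    (hd : ∀ τ : ℂ, 0 < τ.im → DifferentiableAt ℂ F τ)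
    (hT : ∀ τ : ℂ, 0 < τ.im → F (τ + 1) = F τ)
    (hS : ∀ τ : ℂ, 0 < τ.im → F (-1 / τ) = τ ^ k * F τ)
    (h0 : Filter.Tendsto F (Filter.comap Complex.im Filter.atTop) (nhds 0)) {τ : ℂ}
    (hτ : 0 < τ.im) : F τ = 0 := by
  obtain ⟨f, hf⟩ := exists_cuspForm (k := k) hd hT (by simpa using hS) h0
  have : f = 0 := rank_zero_iff_forall_zero.1 (CuspForm.rank_eq_zero_of_weight_lt_twelve
    (by exact_mod_cast hk)) f
  have h1 := hf ⟨τ, hτ⟩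
  rw [this] at h1
  exact h1.symm

open UpperHalfPlane ModularForm MatrixGroups in
-- The cusp forms of weight 12 are spanned by the discriminant `η²⁴`.
theorem exists_eq_mul_eta_pow {F : ℂ → ℂ} (hd : ∀ τ : ℂ, 0 < τ.im → DifferentiableAt ℂ F τ)
    (hT : ∀ τ : ℂ, 0 < τ.im → F (τ + 1) = F τ)
    (hS : ∀ τ : ℂ, 0 < τ.im → F (-1 / τ) = τ ^ 12 * F τ)
    (h0 : Filter.Tendsto F (Filter.comap Complex.im Filter.atTop) (nhds 0)) :
    ∃ c : ℂ, ∀ τ : ℂ, 0 < τ.im → F τ = c * ModularForm.eta τ ^ 24 := by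
  obtain ⟨f, hf⟩ := exists_cuspForm (k := 12) hd hT (fun τ hτ => by exact_mod_cast hS τ hτ) h0
  obtain ⟨c, hc⟩ := CuspForm.exists_smul_discriminant_of_weight_eq_twelve f
  refine ⟨c, fun τ hτ => ?_⟩
  have h1 := hf ⟨τ, hτ⟩
  rw [← hc] at h1
  exact h1.symm

/-- The derivative of a function with a limit at `i∞` tends to zero. -/
theorem tendsto_deriv_zero_of_tendsto {F : ℂ → ℂ} {l : ℂ}
    (hd : ∀ τ : ℂ, 0 < τ.im → DifferentiableAt ℂ F τ)
    (h : Filter.Tendsto F (Filter.comap Complex.im Filter.atTop) (nhds l)) :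
    Filter.Tendsto (deriv F) (Filter.comap Complex.im Filter.atTop) (nhds 0) := by
  rw [Metric.tendsto_nhds] at h ⊢
  intro ε hε
  have h1 := h (ε / 2) (half_pos hε)
  rw [Filter.eventually_comap, Filter.eventually_atTop] at h1
  obtain ⟨M, hM⟩ := h1
  rw [Filter.eventually_comap, Filter.eventually_atTop]
  refine ⟨max M 0 + 2, ?_⟩
  rintro y hy τ rfl
  have hball : ∀ w ∈ Metric.closedBall τ 1, max M 0 + 1 ≤ w.im := by
    intro w hw
    rw [Metric.mem_closedBall, dist_eq_norm] at hw
    have := (Complex.abs_im_le_norm (w - τ)).trans hw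
    rw [Complex.sub_im, abs_le] at this
    linarith [this.1]
  have hpos : ∀ w ∈ Metric.closedBall τ 1, 0 < w.im := fun w hw => by
    linarith [hball w hw, le_max_right M 0]
  -- Cauchy's estimate for `F - l` on the unit disc about `τ`, which stays high in the half-plane.
  have h2 := Complex.norm_deriv_le_of_forall_mem_sphere_norm_le (f := fun w => F w - l) (c := τ)
    (C := ε / 2) one_pos
    (DifferentiableOn.diffContOnCl_ball (U := Metric.closedBall τ 1) (fun w hw =>
      ((hd w (hpos w hw)).sub_const l).differentiableWithinAt) le_rfl)
    (fun w hw => by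
      rw [← dist_eq_norm]
      exact (hM w.im (by linarith [hball w (Metric.sphere_subset_closedBall hw), le_max_left M 0])
        w rfl).le)
  rw [deriv_sub_const, div_one] at h2
  rw [dist_zero_right]
  linarith

theorem neg_one_div_im_pos {τ : ℂ} (hτ : 0 < τ.im) : 0 < (-1 / τ).im := by
  have h0 : τ ≠ 0 := by rintro rfl; simp at hτ
  rw [neg_div, one_div, neg_im, inv_im, neg_div, neg_neg]
  exact div_pos hτ (normSq_pos.2 h0)

theorem ne_zero_of_im_pos {τ : ℂ} (hτ : 0 < τ.im) : τ ≠ 0 := by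
  rintro rfl; simp at hτ

/-! ### Transformation behaviour of the squares of the theta constants -/

/-- The functional equation of `jacobiTheta₂` at argument `0`; squaring removes the branch of
`(-iτ)^(1/2)`. The next two use the arguments `τ/2` and `1/2`. -/
theorem theta3_neg_one_div_sq {τ : ℂ} (hτ : 0 < τ.im) :
    theta3 (-1 / τ) ^ 2 = -I * τ * theta3 τ ^ 2 := by
  have hs : (-I * τ) ^ (1 / 2 : ℂ) ≠ 0 := by
    simp [cpow_eq_zero_iff, ne_zero_of_im_pos hτ]
  have hs2 : ((-I * τ) ^ (1 / 2 : ℂ)) ^ 2 = -I * τ := by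
    rw [← cpow_nat_mul]; norm_num
  rw [theta3_eq_jacobiTheta, theta3_eq_jacobiTheta, jacobiTheta_eq_jacobiTheta₂,
    jacobiTheta_eq_jacobiTheta₂, jacobiTheta₂_functional_equation 0 τ]
  simp only [zero_div, mul_pow, div_pow, hs2, one_pow, ne_eq, OfNat.ofNat_ne_zero,
    not_false_eq_true, zero_pow, mul_zero, Complex.exp_zero, mul_one]
  have := ne_zero_of_im_pos hτ
  field_simp [I_ne_zero]

theorem theta4_neg_one_div_sq {τ : ℂ} (hτ : 0 < τ.im) :
    theta4 (-1 / τ) ^ 2 = -I * τ * theta2 τ ^ 2 := by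
  have h0 := ne_zero_of_im_pos hτ
  have hs2 : ((-I * τ) ^ (1 / 2 : ℂ)) ^ 2 = -I * τ := by
    rw [← cpow_nat_mul]; norm_num
  have e1 : -Real.pi * I * (τ / 2) ^ 2 / τ = -(Real.pi * I * τ / 4) := by field_simp; ring
  have e2 : τ / 2 / τ = 1 / 2 := by field_simp
  rw [theta4_eq_jacobiTheta₂, theta2_eq_jacobiTheta₂, jacobiTheta₂_functional_equation (τ / 2) τ,
    e1, e2, exp_neg]
  simp only [mul_pow, div_pow, hs2, one_pow, inv_pow]
  have := exp_ne_zero (Real.pi * I * τ / 4)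
  field_simp [I_ne_zero]

theorem theta2_neg_one_div_sq {τ : ℂ} (hτ : 0 < τ.im) :
    theta2 (-1 / τ) ^ 2 = -I * τ * theta4 τ ^ 2 := by
  have h0 := ne_zero_of_im_pos hτ
  have hs2 : ((-I * τ) ^ (1 / 2 : ℂ)) ^ 2 = -I * τ := by
    rw [← cpow_nat_mul]; norm_num
  have e1 : -Real.pi * I * (1 / 2) ^ 2 / τ = Real.pi * I * (-1 / τ) / 4 := by field_simp; ring
  have e2 : -1 / τ / 2 = -(1 / 2 / τ) := by field_simp
  rw [theta4_eq_jacobiTheta₂, theta2_eq_jacobiTheta₂, jacobiTheta₂_functional_equation (1 / 2) τ,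
    e1, e2, jacobiTheta₂_neg_left]
  simp only [mul_pow, div_pow, hs2, one_pow]
  field_simp [I_ne_zero]

theorem exp_pi_mul_I_mul_sq (k : ℤ) : exp ((k : ℂ) ^ 2 * (Real.pi * I)) = (-1) ^ k := by
  rw [show (k : ℂ) ^ 2 * (Real.pi * I) = ((k ^ 2 : ℤ) : ℂ) * (Real.pi * I) by push_cast; ring,
    exp_int_mul, exp_pi_mul_I]
  rcases Int.even_or_odd k with hk | hk
  · rw [hk.neg_one_zpow, (hk.pow_of_ne_zero two_ne_zero).neg_one_zpow]
  · rw [hk.neg_one_zpow, hk.pow.neg_one_zpow]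

theorem theta3_add_one (τ : ℂ) : theta3 (τ + 1) = theta4 τ := by
  unfold theta3 theta4
  refine tsum_congr fun k => ?_
  rw [← exp_pi_mul_I_mul_sq, ← exp_add]
  ring_nf

theorem theta4_add_one (τ : ℂ) : theta4 (τ + 1) = theta3 τ := by
  rw [← theta3_add_one, add_assoc, one_add_one_eq_two, theta3_eq_jacobiTheta,
    theta3_eq_jacobiTheta, add_comm, jacobiTheta_two_add]

/-- The series `∑ e^{(k² + k)πiτ}` in `ϑ₂`. -/
def theta2Aux (τ : ℂ) : ℂ := ∑' k : ℤ, exp (((k : ℂ) ^ 2 + k) * (Real.pi * I * τ))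

theorem theta2_eq (τ : ℂ) : theta2 τ = exp (Real.pi * I * τ / 4) * theta2Aux τ := rfl

theorem theta2_sq (τ : ℂ) : theta2 τ ^ 2 = exp (Real.pi * I * τ / 2) * theta2Aux τ ^ 2 := by
  rw [theta2_eq, mul_pow, ← exp_nat_mul]
  ring_nf

theorem theta2Aux_add_one (τ : ℂ) : theta2Aux (τ + 1) = theta2Aux τ := by
  unfold theta2Aux
  refine tsum_congr fun k => ?_
  obtain ⟨m, hm⟩ := Int.even_mul_succ_self k
  have hm' : (k : ℂ) ^ 2 + k = 2 * m := by
    have : ((k * (k + 1) : ℤ) : ℂ) = ((m + m : ℤ) : ℂ) := by rw [hm]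
    push_cast at this
    linear_combination this
  rw [exp_eq_exp_iff_exists_int]
  exact ⟨m, by rw [hm']; ring⟩

theorem theta2_add_one_sq (τ : ℂ) : theta2 (τ + 1) ^ 2 = I * theta2 τ ^ 2 := by
  have : exp (Real.pi * I * (τ + 1) / 2) = I * exp (Real.pi * I * τ / 2) := by
    nth_rw 2 [← exp_pi_div_two_mul_I]
    rw [← exp_add]
    ring_nf
  rw [theta2_sq, theta2_sq, theta2Aux_add_one, this]
  ring

/-! ### Differentiability -/

theorem differentiableAt_theta3 {τ : ℂ} (hτ : 0 < τ.im) : DifferentiableAt ℂ theta3 τ := by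
  rw [show theta3 = jacobiTheta from funext theta3_eq_jacobiTheta]
  exact differentiableAt_jacobiTheta hτ

theorem differentiableAt_theta4 {τ : ℂ} (hτ : 0 < τ.im) : DifferentiableAt ℂ theta4 τ := by
  rw [show theta4 = fun τ => jacobiTheta₂ (1 / 2) τ from funext theta4_eq_jacobiTheta₂]
  exact differentiableAt_jacobiTheta₂_snd _ hτ

theorem theta2Aux_eq (τ : ℂ) : theta2Aux τ = jacobiTheta₂ (τ / 2) τ := by
  have := theta2_eq_jacobiTheta₂ τ
  rw [theta2_eq] at this
  exact mul_left_cancel₀ (exp_ne_zero _) this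

theorem differentiableAt_theta2Aux {τ : ℂ} (hτ : 0 < τ.im) : DifferentiableAt ℂ theta2Aux τ := by
  rw [show theta2Aux = fun τ => jacobiTheta₂ (τ / 2) τ from funext theta2Aux_eq]
  have h1 : DifferentiableAt ℂ (fun τ : ℂ => (τ / 2, τ)) τ := by fun_prop
  have h2 := (hasFDerivAt_jacobiTheta₂ (τ / 2) hτ).differentiableAt
  exact DifferentiableAt.comp (f := fun τ : ℂ => (τ / 2, τ)) τ h2 h1

theorem differentiableAt_theta2 {τ : ℂ} (hτ : 0 < τ.im) : DifferentiableAt ℂ theta2 τ := by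
  have := differentiableAt_theta2Aux hτ
  rw [show theta2 = fun τ => exp (Real.pi * I * τ / 4) * theta2Aux τ from funext theta2_eq]
  fun_prop

/-! ### Behaviour at `i∞` -/

theorem tendsto_theta3 :
    Filter.Tendsto theta3 (Filter.comap Complex.im Filter.atTop) (nhds 1) := by
  rw [show theta3 = jacobiTheta from funext theta3_eq_jacobiTheta, tendsto_iff_norm_sub_tendsto_zero]
  have h := isBigO_at_im_infty_jacobiTheta_sub_one
  refine (h.trans_tendsto ?_).norm.trans (by simp)
  have : Filter.Tendsto (fun y : ℝ => Real.exp (-Real.pi * y)) Filter.atTop (nhds 0) :=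
    Real.tendsto_exp_atBot.comp
      (Filter.tendsto_id.const_mul_atTop_of_neg (neg_lt_zero.2 Real.pi_pos))
  exact this.comp Filter.tendsto_comap

theorem tendsto_comap_im_add_one : Filter.Tendsto (fun τ : ℂ => τ + 1)
    (Filter.comap Complex.im Filter.atTop) (Filter.comap Complex.im Filter.atTop) := by
  rw [Filter.tendsto_comap_iff]
  refine Filter.tendsto_comap.congr fun τ => ?_
  simp

theorem tendsto_theta4 :
    Filter.Tendsto theta4 (Filter.comap Complex.im Filter.atTop) (nhds 1) :=
  (tendsto_theta3.comp tendsto_comap_im_add_one).congr fun τ => theta3_add_one τ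

/-- The exponent `k² + k` vanishes exactly for `k = 0` and `k = -1`, which yields the limit `2`. The
terms at `Im τ = 1` dominate. -/
theorem tendsto_theta2Aux :
    Filter.Tendsto theta2Aux (Filter.comap Complex.im Filter.atTop) (nhds 2) := by
  have hsum : Summable fun k : ℤ => Real.exp (-Real.pi * ((k : ℝ) ^ 2 + k)) := by
    have := (summable_jacobiTheta₂_term_iff (I / 2) I).2 (by simp)
    refine this.norm.congr fun k => ?_
    rw [norm_jacobiTheta₂_term]
    simp
    ring
  have hlim : ∀ k : ℤ, Filter.Tendsto
      (fun τ : ℂ => exp (((k : ℂ) ^ 2 + k) * (Real.pi * I * τ)))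
      (Filter.comap Complex.im Filter.atTop)
      (nhds (if k ∈ ({0, -1} : Finset ℤ) then 1 else 0)) := by
    intro k
    split_ifs with hk
    · have : (k : ℂ) ^ 2 + k = 0 := by
        simp only [Finset.mem_insert, Finset.mem_singleton] at hk
        rcases hk with rfl | rfl <;> norm_num
      simpa [this] using tendsto_const_nhds
    · have hpos : (0 : ℝ) < (k : ℝ) ^ 2 + k := by
        simp only [Finset.mem_insert, Finset.mem_singleton, not_or] at hk
        have : 0 < k ^ 2 + k := by
          rcases lt_or_gt_of_ne hk.1 with h1 | h1
          · have : k ≤ -2 := by omega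
            nlinarith
          · nlinarith
        exact_mod_cast this
      rw [tendsto_zero_iff_norm_tendsto_zero]
      have : Filter.Tendsto (fun y : ℝ => Real.exp (-(Real.pi * ((k : ℝ) ^ 2 + k)) * y))
          Filter.atTop (nhds 0) := Real.tendsto_exp_atBot.comp
        (Filter.tendsto_id.const_mul_atTop_of_neg (neg_lt_zero.2 (mul_pos Real.pi_pos hpos)))
      refine (this.comp Filter.tendsto_comap).congr fun τ => ?_
      rw [norm_exp]
      have : ((k : ℂ) ^ 2 + k) = (((k : ℝ) ^ 2 + k : ℝ) : ℂ) := by push_cast; ring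
      rw [this, re_ofReal_mul]
      simp
      ring_nf
  have := tendsto_tsum_of_dominated_convergence hsum hlim (by
    have : ∀ᶠ τ : ℂ in Filter.comap Complex.im Filter.atTop, 1 ≤ τ.im :=
      Filter.tendsto_comap.eventually_ge_atTop 1
    filter_upwards [this] with τ hτ k
    rw [norm_exp, Real.exp_le_exp]
    have e : ((k : ℂ) ^ 2 + k) = (((k : ℝ) ^ 2 + k : ℝ) : ℂ) := by push_cast; ring
    rw [e, re_ofReal_mul]
    have hpos : (0 : ℝ) ≤ (k : ℝ) ^ 2 + k := by
      have : 0 ≤ k ^ 2 + k := by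
        rcases le_or_gt 0 k with h1 | h1
        · positivity
        · nlinarith
      exact_mod_cast this
    simp
    nlinarith [mul_nonneg Real.pi_pos.le hpos])
  rw [tsum_eq_sum (s := {0, -1}) (fun k hk => if_neg hk)] at this
  norm_num at this
  exact this

/-! ### Squares of the theta constants, Jacobi's identity and absence of zeros. -/

/-- `ϑ₂²` -/
def sqTheta2 (τ : ℂ) : ℂ := theta2 τ ^ 2
/-- `ϑ₃²` -/
def sqTheta3 (τ : ℂ) : ℂ := theta3 τ ^ 2
/-- `ϑ₄²` -/
def sqTheta4 (τ : ℂ) : ℂ := theta4 τ ^ 2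

theorem sqTheta2_add_one (τ : ℂ) : sqTheta2 (τ + 1) = I * sqTheta2 τ := theta2_add_one_sq τ
theorem sqTheta3_add_one (τ : ℂ) : sqTheta3 (τ + 1) = sqTheta4 τ := by
  simp only [sqTheta3, sqTheta4, theta3_add_one]
theorem sqTheta4_add_one (τ : ℂ) : sqTheta4 (τ + 1) = sqTheta3 τ := by
  simp only [sqTheta3, sqTheta4, theta4_add_one]

section

variable {τ : ℂ} (hτ : 0 < τ.im)
include hτ

theorem sqTheta2_neg_one_div : sqTheta2 (-1 / τ) = -I * τ * sqTheta4 τ := theta2_neg_one_div_sq hτ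
theorem sqTheta3_neg_one_div : sqTheta3 (-1 / τ) = -I * τ * sqTheta3 τ := theta3_neg_one_div_sq hτ
theorem sqTheta4_neg_one_div : sqTheta4 (-1 / τ) = -I * τ * sqTheta2 τ := theta4_neg_one_div_sq hτ

theorem differentiableAt_sqTheta2 : DifferentiableAt ℂ sqTheta2 τ :=
  (differentiableAt_theta2 hτ).pow 2
theorem differentiableAt_sqTheta3 : DifferentiableAt ℂ sqTheta3 τ :=
  (differentiableAt_theta3 hτ).pow 2
theorem differentiableAt_sqTheta4 : DifferentiableAt ℂ sqTheta4 τ :=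
  (differentiableAt_theta4 hτ).pow 2

end

theorem tendsto_sqTheta3 :
    Filter.Tendsto sqTheta3 (Filter.comap Complex.im Filter.atTop) (nhds 1) := by
  have := tendsto_theta3.pow 2
  rwa [one_pow] at this
theorem tendsto_sqTheta4 :
    Filter.Tendsto sqTheta4 (Filter.comap Complex.im Filter.atTop) (nhds 1) := by
  have := tendsto_theta4.pow 2
  rwa [one_pow] at this

theorem tendsto_exp_pi_mul_I {s : ℝ} (hs : 0 < s) :
    Filter.Tendsto (fun τ : ℂ => exp (s * (Real.pi * I * τ)))
      (Filter.comap Complex.im Filter.atTop) (nhds 0) := by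
  rw [tendsto_zero_iff_norm_tendsto_zero]
  have : Filter.Tendsto (fun y : ℝ => Real.exp (-(s * Real.pi) * y))
      Filter.atTop (nhds 0) := Real.tendsto_exp_atBot.comp
    (Filter.tendsto_id.const_mul_atTop_of_neg (neg_lt_zero.2 (mul_pos hs Real.pi_pos)))
  refine (this.comp Filter.tendsto_comap).congr fun τ => ?_
  rw [norm_exp, re_ofReal_mul]
  simp
  ring_nf

theorem tendsto_sqTheta2 :
    Filter.Tendsto sqTheta2 (Filter.comap Complex.im Filter.atTop) (nhds 0) := by
  have h1 := (tendsto_exp_pi_mul_I (s := 1 / 2) (by norm_num)).mul (tendsto_theta2Aux.pow 2)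
  rw [zero_mul] at h1
  refine h1.congr fun τ => ?_
  rw [sqTheta2, theta2_sq]
  congr 2
  push_cast
  ring

/-- Jacobi's identity `ϑ₃⁴ = ϑ₂⁴ + ϑ₄⁴`. -/
theorem sqTheta2_sq {τ : ℂ} (hτ : 0 < τ.im) :
    sqTheta2 τ ^ 2 = sqTheta3 τ ^ 2 - sqTheta4 τ ^ 2 := by
  have hI : I ^ 2 = -1 := I_sq
  have := eq_zero_of_weight_lt_twelve (k := 4)
    -- The difference itself changes sign under `τ + 1`, and under `-1/τ` apart from the factor
    -- `τ²`. Its square is a form of weight 4.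
    (F := fun τ => (sqTheta3 τ ^ 2 - sqTheta4 τ ^ 2 - sqTheta2 τ ^ 2) ^ 2) (by norm_num)
    (fun τ hτ => by
      have := differentiableAt_sqTheta2 hτ
      have := differentiableAt_sqTheta3 hτ
      have := differentiableAt_sqTheta4 hτ
      fun_prop)
    (fun τ hτ => by
      simp only [sqTheta2_add_one, sqTheta3_add_one, sqTheta4_add_one, mul_pow, hI]
      ring)
    (fun τ hτ => by
      simp only [sqTheta2_neg_one_div hτ, sqTheta3_neg_one_div hτ, sqTheta4_neg_one_div hτ,
        mul_pow, neg_sq, hI]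
      ring)
    (by simpa using (((tendsto_sqTheta3.pow 2).sub (tendsto_sqTheta4.pow 2)).sub
      (tendsto_sqTheta2.pow 2)).pow 2) hτ
  linear_combination -(pow_eq_zero_iff two_ne_zero).1 this

/-- `(ϑ₂ϑ₃ϑ₄)⁸` is a multiple of the discriminant. -/
theorem exists_sqTheta_prod_eq : ∃ c : ℂ, c ≠ 0 ∧ ∀ τ : ℂ, 0 < τ.im →
    (sqTheta2 τ * sqTheta3 τ * sqTheta4 τ) ^ 4 = c * ModularForm.eta τ ^ 24 := by
  have hI4 : I ^ 4 = 1 := I_pow_four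
  obtain ⟨c, hc⟩ := exists_eq_mul_eta_pow
    (F := fun τ => (sqTheta2 τ * sqTheta3 τ * sqTheta4 τ) ^ 4)
    (fun τ hτ => by
      have := differentiableAt_sqTheta2 hτ
      have := differentiableAt_sqTheta3 hτ
      have := differentiableAt_sqTheta4 hτ
      fun_prop)
    (fun τ hτ => by
      simp only [sqTheta2_add_one, sqTheta3_add_one, sqTheta4_add_one, mul_pow, hI4]
      ring)
    (fun τ hτ => by
      simp only [sqTheta2_neg_one_div hτ, sqTheta3_neg_one_div hτ, sqTheta4_neg_one_div hτ,
        mul_pow, neg_pow I 4, hI4]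
      ring)
    (by simpa using ((tendsto_sqTheta2.mul tendsto_sqTheta3).mul tendsto_sqTheta4).pow 4)
  refine ⟨c, ?_, hc⟩
  -- Without its exponential factor the product tends to `(2²)⁴ ≠ 0` at `i∞`, so `c` cannot be zero.
  rintro rfl
  have h1 : Filter.Tendsto (fun τ => (theta2Aux τ ^ 2 * sqTheta3 τ * sqTheta4 τ) ^ 4)
      (Filter.comap Complex.im Filter.atTop) (nhds ((2 ^ 2 * 1 * 1) ^ 4)) :=
    (((tendsto_theta2Aux.pow 2).mul tendsto_sqTheta3).mul tendsto_sqTheta4).pow 4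
  have h2 : Filter.Tendsto (fun τ => (theta2Aux τ ^ 2 * sqTheta3 τ * sqTheta4 τ) ^ 4)
      (Filter.comap Complex.im Filter.atTop) (nhds 0) := by
    refine tendsto_const_nhds.congr' ?_
    filter_upwards [Filter.tendsto_comap.eventually_gt_atTop 0] with τ hτ
    have h3 := hc τ hτ
    rw [zero_mul, pow_eq_zero_iff four_ne_zero, sqTheta2, theta2_sq] at h3
    simp only [mul_eq_zero, exp_ne_zero, false_or, pow_eq_zero_iff, ne_eq, OfNat.ofNat_ne_zero,
      not_false_eq_true] at h3
    rcases h3 with (h3 | h3) | h3 <;> simp [h3]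
  have : (Filter.comap Complex.im Filter.atTop).NeBot :=
    Filter.comap_neBot_iff_frequently.2 (Filter.Eventually.frequently
      (Filter.Eventually.of_forall fun y => ⟨y * I, by simp⟩))
  have h4 := tendsto_nhds_unique h1 h2
  norm_num at h4

theorem sqTheta_ne_zero {τ : ℂ} (hτ : 0 < τ.im) :
    sqTheta2 τ ≠ 0 ∧ sqTheta3 τ ≠ 0 ∧ sqTheta4 τ ≠ 0 := by
  obtain ⟨c, hc0, hc⟩ := exists_sqTheta_prod_eq
  have h1 := hc τ hτ
  have h2 : c * ModularForm.eta τ ^ 24 ≠ 0 :=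
    mul_ne_zero hc0 (pow_ne_zero _ (ModularForm.eta_ne_zero hτ))
  rw [← h1] at h2
  have h3 := (pow_ne_zero_iff four_ne_zero).1 h2
  exact ⟨left_ne_zero_of_mul (left_ne_zero_of_mul h3), right_ne_zero_of_mul (left_ne_zero_of_mul h3),
    right_ne_zero_of_mul h3⟩

/-! ### Logarithmic derivatives -/

theorem im_pos_mem_nhds {τ : ℂ} (hτ : 0 < τ.im) : ∀ᶠ w in nhds τ, 0 < w.im :=
  Complex.continuous_im.continuousAt.eventually_const_lt hτ

theorem hasDerivAt_neg_one_div {τ : ℂ} (hτ : τ ≠ 0) :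
    HasDerivAt (fun w : ℂ => -1 / w) (1 / τ ^ 2) τ := by
  refine ((hasDerivAt_const τ (-1 : ℂ)).fun_div (hasDerivAt_id τ) hτ).congr_deriv ?_
  simp

/-- The automorphy factor `-iτ` produces the inhomogeneous term `τ`. It is the same for all three
squares and cancels in differences. -/
theorem logDeriv_neg_one_div {f g : ℂ → ℂ} (hf : ∀ τ : ℂ, 0 < τ.im → DifferentiableAt ℂ f τ)
    (hg : ∀ τ : ℂ, 0 < τ.im → DifferentiableAt ℂ g τ)
    (hfg : ∀ {τ : ℂ}, 0 < τ.im → f (-1 / τ) = -I * τ * g τ) {τ : ℂ} (hτ : 0 < τ.im)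
    (h0 : g τ ≠ 0) : logDeriv f (-1 / τ) = τ ^ 2 * logDeriv g τ + τ := by
  have hτ0 := ne_zero_of_im_pos hτ
  have h1 : HasDerivAt (fun w => f (-1 / w)) (deriv f (-1 / τ) * (1 / τ ^ 2)) τ :=
    (hf _ (neg_one_div_im_pos hτ)).hasDerivAt.comp τ (hasDerivAt_neg_one_div hτ0)
  have h2 : HasDerivAt (fun w => f (-1 / w)) (-I * g τ + -I * τ * deriv g τ) τ := by
    have := ((hasDerivAt_id τ).const_mul (-I)).fun_mul (hg τ hτ).hasDerivAt
    refine (this.congr_of_eventuallyEq ?_).congr_deriv (by simp)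
    filter_upwards [im_pos_mem_nhds hτ] with w hw using hfg hw
  have h3 := h1.unique h2
  rw [logDeriv_apply, logDeriv_apply, hfg hτ]
  have h4 : deriv f (-1 / τ) = τ ^ 2 * (-I * g τ + -I * τ * deriv g τ) := by
    rw [← h3]
    field_simp
  rw [h4]
  field_simp [I_ne_zero]
  ring

theorem logDeriv_add_one {f g : ℂ → ℂ} {c : ℂ} (hc : c ≠ 0) (hfg : ∀ τ : ℂ, f (τ + 1) = c * g τ)
    (τ : ℂ) : logDeriv f (τ + 1) = logDeriv g τ := by
  rw [logDeriv_apply, logDeriv_apply, hfg, ← deriv_comp_add_const,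
    show (fun x => f (x + 1)) = fun x => c * g x from funext hfg, deriv_const_mul_field,
    mul_div_mul_left _ _ hc]

theorem logDeriv_sqTheta2_add_one (τ : ℂ) : logDeriv sqTheta2 (τ + 1) = logDeriv sqTheta2 τ :=
  logDeriv_add_one I_ne_zero sqTheta2_add_one τ
theorem logDeriv_sqTheta3_add_one (τ : ℂ) : logDeriv sqTheta3 (τ + 1) = logDeriv sqTheta4 τ :=
  logDeriv_add_one one_ne_zero (by simpa using sqTheta3_add_one) τ
theorem logDeriv_sqTheta4_add_one (τ : ℂ) : logDeriv sqTheta4 (τ + 1) = logDeriv sqTheta3 τ :=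
  logDeriv_add_one one_ne_zero (by simpa using sqTheta4_add_one) τ

section

variable {τ : ℂ} (hτ : 0 < τ.im)
include hτ

theorem logDeriv_sqTheta2_neg_one_div :
    logDeriv sqTheta2 (-1 / τ) = τ ^ 2 * logDeriv sqTheta4 τ + τ :=
  logDeriv_neg_one_div (fun _ => differentiableAt_sqTheta2) (fun _ => differentiableAt_sqTheta4)
    sqTheta2_neg_one_div hτ (sqTheta_ne_zero hτ).2.2
theorem logDeriv_sqTheta3_neg_one_div :
    logDeriv sqTheta3 (-1 / τ) = τ ^ 2 * logDeriv sqTheta3 τ + τ :=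
  logDeriv_neg_one_div (fun _ => differentiableAt_sqTheta3) (fun _ => differentiableAt_sqTheta3)
    sqTheta3_neg_one_div hτ (sqTheta_ne_zero hτ).2.1
theorem logDeriv_sqTheta4_neg_one_div :
    logDeriv sqTheta4 (-1 / τ) = τ ^ 2 * logDeriv sqTheta2 τ + τ :=
  logDeriv_neg_one_div (fun _ => differentiableAt_sqTheta4) (fun _ => differentiableAt_sqTheta2)
    sqTheta4_neg_one_div hτ (sqTheta_ne_zero hτ).1

theorem differentiableAt_deriv_of_upperHalfPlane {f : ℂ → ℂ}
    (hf : ∀ τ : ℂ, 0 < τ.im → DifferentiableAt ℂ f τ) : DifferentiableAt ℂ (deriv f) τ := by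
  have hopen : IsOpen {w : ℂ | 0 < w.im} := isOpen_lt continuous_const Complex.continuous_im
  exact (DifferentiableOn.deriv (s := {w : ℂ | 0 < w.im})
    (fun w hw => (hf w hw).differentiableWithinAt) hopen).differentiableAt (hopen.mem_nhds hτ)

theorem differentiableAt_logDeriv_of_upperHalfPlane {f : ℂ → ℂ}
    (hf : ∀ τ : ℂ, 0 < τ.im → DifferentiableAt ℂ f τ) (h0 : f τ ≠ 0) :
    DifferentiableAt ℂ (logDeriv f) τ :=
  (differentiableAt_deriv_of_upperHalfPlane hτ hf).div (hf τ hτ) h0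

theorem differentiableAt_logDeriv_sqTheta2 : DifferentiableAt ℂ (logDeriv sqTheta2) τ :=
  differentiableAt_logDeriv_of_upperHalfPlane hτ (fun _ => differentiableAt_sqTheta2)
    (sqTheta_ne_zero hτ).1
theorem differentiableAt_logDeriv_sqTheta3 : DifferentiableAt ℂ (logDeriv sqTheta3) τ :=
  differentiableAt_logDeriv_of_upperHalfPlane hτ (fun _ => differentiableAt_sqTheta3)
    (sqTheta_ne_zero hτ).2.1
theorem differentiableAt_logDeriv_sqTheta4 : DifferentiableAt ℂ (logDeriv sqTheta4) τ :=
  differentiableAt_logDeriv_of_upperHalfPlane hτ (fun _ => differentiableAt_sqTheta4)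
    (sqTheta_ne_zero hτ).2.2

end

theorem tendsto_logDeriv_zero {f : ℂ → ℂ} {l : ℂ}
    (hd : ∀ τ : ℂ, 0 < τ.im → DifferentiableAt ℂ f τ)
    (h : Filter.Tendsto f (Filter.comap Complex.im Filter.atTop) (nhds l)) (hl : l ≠ 0) :
    Filter.Tendsto (logDeriv f) (Filter.comap Complex.im Filter.atTop) (nhds 0) := by
  have := (tendsto_deriv_zero_of_tendsto hd h).div h hl
  rwa [zero_div] at this

theorem tendsto_logDeriv_sqTheta3 :
    Filter.Tendsto (logDeriv sqTheta3) (Filter.comap Complex.im Filter.atTop) (nhds 0) :=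
  tendsto_logDeriv_zero (fun _ => differentiableAt_sqTheta3) tendsto_sqTheta3 one_ne_zero
theorem tendsto_logDeriv_sqTheta4 :
    Filter.Tendsto (logDeriv sqTheta4) (Filter.comap Complex.im Filter.atTop) (nhds 0) :=
  tendsto_logDeriv_zero (fun _ => differentiableAt_sqTheta4) tendsto_sqTheta4 one_ne_zero
-- The factor `e^(πiτ/2)` contributes the limit; the other factor tends to `4 ≠ 0`, so its
-- logarithmic derivative tends to zero.
theorem tendsto_logDeriv_sqTheta2 : Filter.Tendsto (logDeriv sqTheta2)
    (Filter.comap Complex.im Filter.atTop) (nhds (Real.pi * I / 2)) := by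
  have h1 := (tendsto_logDeriv_zero (fun _ hτ => (differentiableAt_theta2Aux hτ).pow 2)
    (tendsto_theta2Aux.pow 2) (by norm_num)).const_add (Real.pi * I / 2)
  rw [add_zero] at h1
  refine h1.congr' ?_
  filter_upwards [Filter.tendsto_comap.eventually_gt_atTop 0] with τ hτ
  have h2 := (sqTheta_ne_zero hτ).1
  rw [sqTheta2, theta2_sq] at h2
  have h3 : sqTheta2 = fun τ => exp (Real.pi * I * τ / 2) * theta2Aux τ ^ 2 := funext theta2_sq
  have h4 : HasDerivAt (fun τ : ℂ => exp (Real.pi * I * τ / 2))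
      (exp (Real.pi * I * τ / 2) * (Real.pi * I / 2)) τ := by
    have : HasDerivAt (fun τ : ℂ => Real.pi * I * τ / 2) (Real.pi * I / 2) τ := by
      simpa using ((hasDerivAt_id τ).const_mul (Real.pi * I)).div_const 2
    exact this.cexp
  rw [h3, logDeriv_mul (g := fun τ => theta2Aux τ ^ 2) τ (left_ne_zero_of_mul h2) (right_ne_zero_of_mul h2) h4.differentiableAt
    ((differentiableAt_theta2Aux hτ).pow 2)]
  congr 1
  rw [logDeriv_apply, h4.deriv, mul_div_cancel_left₀ _ (left_ne_zero_of_mul h2)]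

/-! ### The derivatives of the theta constants -/

/-- The mean of the logarithmic derivatives of `ϑ₂²`, `ϑ₃²`, `ϑ₄²`. -/
def thetaU (τ : ℂ) : ℂ := (logDeriv sqTheta2 τ + logDeriv sqTheta3 τ + logDeriv sqTheta4 τ) / 3

theorem thetaU_add_one (τ : ℂ) : thetaU (τ + 1) = thetaU τ := by
  simp only [thetaU, logDeriv_sqTheta2_add_one, logDeriv_sqTheta3_add_one,
    logDeriv_sqTheta4_add_one]
  ring

theorem thetaU_neg_one_div {τ : ℂ} (hτ : 0 < τ.im) : thetaU (-1 / τ) = τ ^ 2 * thetaU τ + τ := by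
  simp only [thetaU, logDeriv_sqTheta2_neg_one_div hτ, logDeriv_sqTheta3_neg_one_div hτ,
    logDeriv_sqTheta4_neg_one_div hτ]
  ring

theorem differentiableAt_thetaU {τ : ℂ} (hτ : 0 < τ.im) : DifferentiableAt ℂ thetaU τ :=
  (((differentiableAt_logDeriv_sqTheta2 hτ).add (differentiableAt_logDeriv_sqTheta3 hτ)).add
    (differentiableAt_logDeriv_sqTheta4 hτ)).div_const 3

theorem tendsto_thetaU : Filter.Tendsto thetaU (Filter.comap Complex.im Filter.atTop)
    (nhds (Real.pi * I / 6)) := by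
  have := ((tendsto_logDeriv_sqTheta2.add tendsto_logDeriv_sqTheta3).add
    tendsto_logDeriv_sqTheta4).div_const 3
  rwa [show (Real.pi * I / 2 + 0 + 0) / 3 = (Real.pi * I / 6 : ℂ) by ring] at this

/-- The three defects `f2`, `f3`, `f4` are permuted by the generators with weight 2. Their product
is therefore a cusp form of level one and weight 6, hence zero. By the identity theorem one defect
vanishes identically, and the permutations carry this to the others. -/
theorem logDeriv_sqTheta_eq {τ : ℂ} (hτ : 0 < τ.im) :
    logDeriv sqTheta2 τ = thetaU τ + Real.pi * I / 6 * (sqTheta3 τ ^ 2 + sqTheta4 τ ^ 2) ∧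
    logDeriv sqTheta3 τ = thetaU τ + Real.pi * I / 6 * (sqTheta3 τ ^ 2 - 2 * sqTheta4 τ ^ 2) ∧
    logDeriv sqTheta4 τ = thetaU τ + Real.pi * I / 6 * (sqTheta4 τ ^ 2 - 2 * sqTheta3 τ ^ 2) := by
  set ω : ℂ := Real.pi * I / 6 with hω
  have hI : I ^ 2 = -1 := I_sq
  set f2 : ℂ → ℂ := fun τ => logDeriv sqTheta2 τ - thetaU τ -
    ω * (sqTheta3 τ ^ 2 + sqTheta4 τ ^ 2) with hf2
  set f3 : ℂ → ℂ := fun τ => logDeriv sqTheta3 τ - thetaU τ -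
    ω * (sqTheta3 τ ^ 2 - 2 * sqTheta4 τ ^ 2) with hf3
  set f4 : ℂ → ℂ := fun τ => logDeriv sqTheta4 τ - thetaU τ -
    ω * (sqTheta4 τ ^ 2 - 2 * sqTheta3 τ ^ 2) with hf4
  have T2 : ∀ τ, f2 (τ + 1) = f2 τ := fun τ => by
    simp only [hf2, logDeriv_sqTheta2_add_one, thetaU_add_one, sqTheta3_add_one, sqTheta4_add_one]
    ring
  have T3 : ∀ τ, f3 (τ + 1) = f4 τ := fun τ => by
    simp only [hf3, hf4, logDeriv_sqTheta3_add_one, thetaU_add_one, sqTheta3_add_one,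
      sqTheta4_add_one]
  have T4 : ∀ τ, f4 (τ + 1) = f3 τ := fun τ => by
    simp only [hf3, hf4, logDeriv_sqTheta4_add_one, thetaU_add_one, sqTheta3_add_one,
      sqTheta4_add_one]
  have S2 : ∀ τ : ℂ, 0 < τ.im → f2 (-1 / τ) = τ ^ 2 * f4 τ := fun τ hτ => by
    simp only [hf2, hf4, logDeriv_sqTheta2_neg_one_div hτ, thetaU_neg_one_div hτ,
      sqTheta3_neg_one_div hτ, sqTheta4_neg_one_div hτ, mul_pow, neg_sq, hI, sqTheta2_sq hτ]
    ring
  have S3 : ∀ τ : ℂ, 0 < τ.im → f3 (-1 / τ) = τ ^ 2 * f3 τ := fun τ hτ => by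
    simp only [hf3, logDeriv_sqTheta3_neg_one_div hτ, thetaU_neg_one_div hτ,
      sqTheta3_neg_one_div hτ, sqTheta4_neg_one_div hτ, mul_pow, neg_sq, hI, sqTheta2_sq hτ]
    ring
  have S4 : ∀ τ : ℂ, 0 < τ.im → f4 (-1 / τ) = τ ^ 2 * f2 τ := fun τ hτ => by
    simp only [hf2, hf4, logDeriv_sqTheta4_neg_one_div hτ, thetaU_neg_one_div hτ,
      sqTheta3_neg_one_div hτ, sqTheta4_neg_one_div hτ, mul_pow, neg_sq, hI, sqTheta2_sq hτ]
    ring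
  have d2 : ∀ τ : ℂ, 0 < τ.im → DifferentiableAt ℂ f2 τ := fun τ hτ => by
    have := differentiableAt_logDeriv_sqTheta2 hτ
    have := differentiableAt_thetaU hτ
    have := differentiableAt_sqTheta3 hτ
    have := differentiableAt_sqTheta4 hτ
    fun_prop
  have d3 : ∀ τ : ℂ, 0 < τ.im → DifferentiableAt ℂ f3 τ := fun τ hτ => by
    have := differentiableAt_logDeriv_sqTheta3 hτ
    have := differentiableAt_thetaU hτ
    have := differentiableAt_sqTheta3 hτ
    have := differentiableAt_sqTheta4 hτ
    fun_prop
  have d4 : ∀ τ : ℂ, 0 < τ.im → DifferentiableAt ℂ f4 τ := fun τ hτ => by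
    have := differentiableAt_logDeriv_sqTheta4 hτ
    have := differentiableAt_thetaU hτ
    have := differentiableAt_sqTheta3 hτ
    have := differentiableAt_sqTheta4 hτ
    fun_prop
  have l2 : Filter.Tendsto f2 (Filter.comap Complex.im Filter.atTop) (nhds 0) := by
    have := (tendsto_logDeriv_sqTheta2.sub tendsto_thetaU).sub
      (((tendsto_sqTheta3.pow 2).add (tendsto_sqTheta4.pow 2)).const_mul ω)
    convert this using 2
    rw [hω]
    ring
  have l3 : Filter.Tendsto f3 (Filter.comap Complex.im Filter.atTop) (nhds 0) := by
    have := (tendsto_logDeriv_sqTheta3.sub tendsto_thetaU).sub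
      (((tendsto_sqTheta3.pow 2).sub ((tendsto_sqTheta4.pow 2).const_mul 2)).const_mul ω)
    convert this using 2
    rw [hω]
    ring
  have l4 : Filter.Tendsto f4 (Filter.comap Complex.im Filter.atTop) (nhds 0) := by
    have := (tendsto_logDeriv_sqTheta4.sub tendsto_thetaU).sub
      (((tendsto_sqTheta4.pow 2).sub ((tendsto_sqTheta3.pow 2).const_mul 2)).const_mul ω)
    convert this using 2
    rw [hω]
    ring
  have hprod : ∀ τ : ℂ, 0 < τ.im → f2 τ * f3 τ * f4 τ = 0 := fun τ hτ =>
    eq_zero_of_weight_lt_twelve (k := 6) (F := fun τ => f2 τ * f3 τ * f4 τ) (by norm_num)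
      (fun τ hτ => ((d2 τ hτ).mul (d3 τ hτ)).mul (d4 τ hτ))
      (fun τ hτ => by simp only [T2, T3, T4]; ring)
      (fun τ hτ => by simp only [S2 τ hτ, S3 τ hτ, S4 τ hτ]; ring)
      (by simpa using (l2.mul l3).mul l4) hτ
  have hopen : IsOpen {w : ℂ | 0 < w.im} := isOpen_lt continuous_const Complex.continuous_im
  have hconn : IsPreconnected {w : ℂ | 0 < w.im} :=
    (convex_halfSpace_im_gt 0).isPreconnected
  have an : ∀ {f : ℂ → ℂ}, (∀ τ : ℂ, 0 < τ.im → DifferentiableAt ℂ f τ) →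
      AnalyticOnNhd ℂ f {w : ℂ | 0 < w.im} := fun h =>
    DifferentiableOn.analyticOnNhd (fun w hw => (h w hw).differentiableWithinAt) hopen
  have c34 : (∀ τ : ℂ, 0 < τ.im → f3 τ = 0) → ∀ τ : ℂ, 0 < τ.im → f4 τ = 0 := fun h τ hτ => by
    rw [← T3]; exact h _ (by simpa using hτ)
  have c43 : (∀ τ : ℂ, 0 < τ.im → f4 τ = 0) → ∀ τ : ℂ, 0 < τ.im → f3 τ = 0 := fun h τ hτ => by
    rw [← T4]; exact h _ (by simpa using hτ)
  have c42 : (∀ τ : ℂ, 0 < τ.im → f4 τ = 0) → ∀ τ : ℂ, 0 < τ.im → f2 τ = 0 := fun h τ hτ => by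
    have := (S4 τ hτ).symm.trans (h _ (neg_one_div_im_pos hτ))
    simpa [ne_zero_of_im_pos hτ] using this
  have c24 : (∀ τ : ℂ, 0 < τ.im → f2 τ = 0) → ∀ τ : ℂ, 0 < τ.im → f4 τ = 0 := fun h τ hτ => by
    have := (S2 τ hτ).symm.trans (h _ (neg_one_div_im_pos hτ))
    simpa [ne_zero_of_im_pos hτ] using this
  have h4 : ∀ τ : ℂ, 0 < τ.im → f4 τ = 0 := by
    rcases (((an d2).mul (an d3))).eq_zero_or_eq_zero_of_mul_eq_zero (an d4) hprod hconn with h | h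
    · rcases (an d2).eq_zero_or_eq_zero_of_mul_eq_zero (an d3) h hconn with h | h
      · exact c24 h
      · exact c34 h
    · exact h
  have e2 := c42 h4 τ hτ
  have e3 := c43 h4 τ hτ
  have e4 := h4 τ hτ
  exact ⟨by linear_combination e2, by linear_combination e3, by linear_combination e4⟩

/-- In `deriv thetaU - thetaU²` the inhomogeneous terms cancel, leaving weight 4; the quartic in the
thetas has the same weight, and the limits at `i∞` cancel. This is Ramanujan's equation for `E₂`. -/
theorem deriv_thetaU {τ : ℂ} (hτ : 0 < τ.im) :
    deriv thetaU τ = thetaU τ ^ 2 - (Real.pi * I / 6) ^ 2 *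
      (sqTheta3 τ ^ 4 - sqTheta3 τ ^ 2 * sqTheta4 τ ^ 2 + sqTheta4 τ ^ 4) := by
  set ω : ℂ := Real.pi * I / 6 with hω
  have hI : I ^ 2 = -1 := I_sq
  have hI4 : I ^ 4 = 1 := I_pow_four
  have key := eq_zero_of_weight_lt_twelve (k := 4) (F := fun τ => deriv thetaU τ - thetaU τ ^ 2 +
      ω ^ 2 * (sqTheta3 τ ^ 4 - sqTheta3 τ ^ 2 * sqTheta4 τ ^ 2 + sqTheta4 τ ^ 4)) (by norm_num)
    (fun τ hτ => by
      have := differentiableAt_thetaU hτ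
      have := differentiableAt_deriv_of_upperHalfPlane hτ (fun _ => differentiableAt_thetaU)
      have := differentiableAt_sqTheta3 hτ
      have := differentiableAt_sqTheta4 hτ
      fun_prop)
    (fun τ hτ => by
      simp only [thetaU_add_one, sqTheta3_add_one, sqTheta4_add_one]
      rw [← deriv_comp_add_const, show (fun x => thetaU (x + 1)) = thetaU from
        funext thetaU_add_one]
      ring)
    (fun τ hτ => by
      have hτ0 := ne_zero_of_im_pos hτ
      have h1 : HasDerivAt (fun w => thetaU (-1 / w)) (deriv thetaU (-1 / τ) * (1 / τ ^ 2)) τ :=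
        (differentiableAt_thetaU (neg_one_div_im_pos hτ)).hasDerivAt.comp τ
          (hasDerivAt_neg_one_div hτ0)
      have h2 : HasDerivAt (fun w => thetaU (-1 / w))
          (2 * τ * thetaU τ + τ ^ 2 * deriv thetaU τ + 1) τ := by
        have := (((hasDerivAt_id τ).fun_pow 2).fun_mul
          (differentiableAt_thetaU hτ).hasDerivAt).fun_add (hasDerivAt_id τ)
        refine (this.congr_of_eventuallyEq ?_).congr_deriv (by simp)
        filter_upwards [im_pos_mem_nhds hτ] with w hw using thetaU_neg_one_div hw
      have h3 : deriv thetaU (-1 / τ) =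
          τ ^ 2 * (2 * τ * thetaU τ + τ ^ 2 * deriv thetaU τ + 1) := by
        rw [← h1.unique h2]
        field_simp
      have h4 : sqTheta2 τ ^ 4 = (sqTheta3 τ ^ 2 - sqTheta4 τ ^ 2) ^ 2 := by
        rw [← sqTheta2_sq hτ]; ring
      simp only [thetaU_neg_one_div hτ, sqTheta3_neg_one_div hτ, sqTheta4_neg_one_div hτ, h3,
        mul_pow, neg_sq, neg_pow I 4, hI, hI4, sqTheta2_sq hτ, h4]
      ring)
    (by
      have := ((tendsto_deriv_zero_of_tendsto (fun _ => differentiableAt_thetaU)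
        tendsto_thetaU).sub (tendsto_thetaU.pow 2)).add
        ((((tendsto_sqTheta3.pow 4).sub ((tendsto_sqTheta3.pow 2).mul
          (tendsto_sqTheta4.pow 2))).add (tendsto_sqTheta4.pow 4)).const_mul (ω ^ 2))
      convert this using 2
      rw [hω]
      ring) hτ
  linear_combination key

/-! ### Weierstrass' `η` -/

open EisensteinSeries in
-- Expanding `q^k / (1 - q^k)²` as `∑ c q^(kc)` turns the series into `∑ σ₁(n) q^n`.
theorem weierstrassEta_eq (τ : UpperHalfPlane) :
    weierstrassEta τ = (Real.pi : ℂ) ^ 2 / 12 * E2 τ := by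
  have hr : ‖exp (2 * Real.pi * I * τ)‖ < 1 := UpperHalfPlane.norm_exp_two_pi_I_lt_one τ
  have h1 : ∑' k : ℕ, exp (2 * ((k : ℂ) + 1) * (Real.pi * I * τ)) /
      (1 - exp (2 * ((k : ℂ) + 1) * (Real.pi * I * τ))) ^ 2 =
      ∑' n : ℕ+, (ArithmeticFunction.sigma 1 n : ℂ) * exp (2 * Real.pi * I * τ) ^ (n : ℕ) := by
    rw [← tsum_prod_pow_eq_tsum_sigma 1 hr, tsum_pnat_eq_tsum_succ
      (f := fun d : ℕ => ∑' c : ℕ+, (c : ℂ) ^ 1 * exp (2 * Real.pi * I * τ) ^ (d * c : ℕ))]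
    refine tsum_congr fun k => ?_
    have h2 : exp (2 * ((k : ℂ) + 1) * (Real.pi * I * τ)) =
        exp (2 * Real.pi * I * τ) ^ (k + 1) := by
      rw [← exp_nat_mul]
      push_cast
      ring_nf
    have h3 : ‖exp (2 * Real.pi * I * τ) ^ (k + 1)‖ < 1 := by
      rw [norm_pow]
      exact pow_lt_one₀ (norm_nonneg _) hr (Nat.succ_ne_zero k)
    rw [h2, ← tsum_coe_mul_geometric_of_norm_lt_one h3, tsum_pnat_eq_tsum_succ
      (f := fun c : ℕ => (c : ℂ) ^ 1 * exp (2 * Real.pi * I * τ) ^ ((k + 1) * c : ℕ)),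
      (hasSum_coe_mul_geometric_of_norm_lt_one h3).summable.tsum_eq_zero_add]
    simp [pow_mul]
  rw [weierstrassEta, h1, E2_eq_tsum_cexp]
  ring

/-- Logarithmic differentiation of `(ϑ₂ϑ₃ϑ₄)⁸ = c η²⁴` (Dedekind's `η`): the left side gives `12
thetaU`, the right side a multiple of `E₂`. -/
theorem thetaU_eq_weierstrassEta {τ : ℂ} (hτ : 0 < τ.im) :
    thetaU τ = 2 * I / Real.pi * weierstrassEta τ := by
  obtain ⟨c, hc0, hc⟩ := exists_sqTheta_prod_eq
  obtain ⟨n2, n3, n4⟩ := sqTheta_ne_zero hτ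
  have d2 := differentiableAt_sqTheta2 hτ
  have d3 := differentiableAt_sqTheta3 hτ
  have d4 := differentiableAt_sqTheta4 hτ
  have h1 : logDeriv (fun τ => (sqTheta2 τ * sqTheta3 τ * sqTheta4 τ) ^ 4) τ =
      logDeriv (fun τ => c * ModularForm.eta τ ^ 24) τ := by
    have : (fun τ => (sqTheta2 τ * sqTheta3 τ * sqTheta4 τ) ^ 4) =ᶠ[nhds τ]
        fun τ => c * ModularForm.eta τ ^ 24 := by
      filter_upwards [im_pos_mem_nhds hτ] with w hw using hc w hw
    rw [logDeriv_apply, logDeriv_apply, this.deriv_eq, this.eq_of_nhds]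
  rw [logDeriv_const_mul τ c hc0, logDeriv_fun_pow
    (ModularForm.differentiableAt_eta_of_mem_upperHalfPlaneSet hτ), logDeriv_fun_pow (by fun_prop),
    logDeriv_mul (f := fun τ => sqTheta2 τ * sqTheta3 τ) τ (mul_ne_zero n2 n3) n4 (by fun_prop) d4,
    logDeriv_mul τ n2 n3 d2 d3, ModularForm.logDeriv_eta_eq_E2 ⟨τ, hτ⟩] at h1
  have h2 := weierstrassEta_eq ⟨τ, hτ⟩
  have hpi : (Real.pi : ℂ) ≠ 0 := by exact_mod_cast Real.pi_ne_zero
  rw [UpperHalfPlane.coe_mk] at h2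
  rw [h2, thetaU]
  push_cast at h1
  field_simp
  linear_combination 3 * h1

/-! ### The theta-functional solutions -/

/-- Multiplying by the conjugate denominator gives a function continuous everywhere, also at zeros
of `γτ + δ`, where it vanishes. This form is needed at the boundary of the domain. -/
theorem linFracDomain_eq (α β γ δ : ℂ) : linFracDomain α β γ δ =
    {τ | 0 < ((α * τ + β) * (starRingEnd ℂ) (γ * τ + δ)).im} := by
  ext τ
  simp only [linFracDomain, linFrac, Set.mem_ofPred_eq]
  have key : γ * τ + δ ≠ 0 → ((α * τ + β) / (γ * τ + δ)).im =
      ((α * τ + β) * (starRingEnd ℂ) (γ * τ + δ)).im / normSq (γ * τ + δ) := fun h => by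
    rw [div_eq_mul_inv, inv_def, ← mul_assoc, im_mul_ofReal, div_eq_mul_inv]
  constructor
  · rintro ⟨h1, h2⟩
    rw [key h1] at h2
    exact (div_pos_iff_of_pos_right (normSq_pos.2 h1)).1 h2
  · intro h
    have h1 : γ * τ + δ ≠ 0 := by
      intro h0
      simp [h0] at h
    exact ⟨h1, by rw [key h1]; exact div_pos h (normSq_pos.2 h1)⟩

theorem isOpen_linFracDomain (α β γ δ : ℂ) : IsOpen (linFracDomain α β γ δ) := by
  rw [linFracDomain_eq]
  exact isOpen_lt continuous_const (by fun_prop)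

theorem hasDerivAt_linFrac {α β γ δ τ : ℂ} (hdet : α * δ - β * γ = 1) (h : γ * τ + δ ≠ 0) :
    HasDerivAt (linFrac α β γ δ) (1 / (γ * τ + δ) ^ 2) τ := by
  have h1 : HasDerivAt (fun τ => α * τ + β) α τ := by
    simpa using ((hasDerivAt_id τ).const_mul α).add_const β
  have h2 : HasDerivAt (fun τ => γ * τ + δ) γ τ := by
    simpa using ((hasDerivAt_id τ).const_mul γ).add_const δ
  refine (h1.fun_div h2 h).congr_deriv ?_
  congr 1
  linear_combination hdet

/-- Differentiation of a form of weight one composed with a linear fractional substitution. -/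
theorem hasDerivAt_weight_one {f : ℂ → ℂ} {α β γ δ τ : ℂ} (s : ℂ) (hdet : α * δ - β * γ = 1)
    (h : γ * τ + δ ≠ 0) (hf : DifferentiableAt ℂ f (linFrac α β γ δ τ))
    (h0 : f (linFrac α β γ δ τ) ≠ 0) :
    HasDerivAt (fun τ => s * (f (linFrac α β γ δ τ) / (γ * τ + δ)))
      ((logDeriv f (linFrac α β γ δ τ) / (γ * τ + δ) ^ 2 - γ / (γ * τ + δ)) *
        (s * (f (linFrac α β γ δ τ) / (γ * τ + δ)))) τ := by
  have h2 : HasDerivAt (fun τ => γ * τ + δ) γ τ := by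
    simpa using ((hasDerivAt_id τ).const_mul γ).add_const δ
  have h3 := hf.hasDerivAt.comp τ (hasDerivAt_linFrac hdet h)
  refine ((h3.fun_div h2 h).const_mul s).congr_deriv ?_
  rw [logDeriv_apply]
  simp only [Function.comp_apply]
  field_simp

/-- The scaling `c² = πi/6` absorbs the constant of `logDeriv_sqTheta_eq`, and `-γ / (γτ + δ)` in
`u` is the logarithmic derivative of the denominator. -/
theorem isCanonicalSolution_theta {c ε α β γ δ : ℂ} (hc : c ^ 2 = Real.pi * I / 6)
    (hdet : α * δ - β * γ = 1) :
    IsCanonicalSolution (linFracDomain α β γ δ)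
      (fun τ => ε * (sqTheta2 (linFrac α β γ δ τ) / (γ * τ + δ)))
      (fun τ => c * (sqTheta3 (linFrac α β γ δ τ) / (γ * τ + δ)))
      (fun τ => c * (sqTheta4 (linFrac α β γ δ τ) / (γ * τ + δ)))
      (fun τ => thetaU (linFrac α β γ δ τ) / (γ * τ + δ) ^ 2 - γ / (γ * τ + δ)) := by
  refine ⟨?_, ?_, ?_, ?_⟩ <;> rintro τ ⟨hl, hT⟩ <;>
    obtain ⟨n2, n3, n4⟩ := sqTheta_ne_zero hT <;>
    obtain ⟨e2, e3, e4⟩ := logDeriv_sqTheta_eq hT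
  · refine (hasDerivAt_weight_one ε hdet hl (differentiableAt_sqTheta2 hT) n2).congr_deriv ?_
    congr 1
    simp only [mul_pow, div_pow, hc, e2]
    ring
  · refine (hasDerivAt_weight_one c hdet hl (differentiableAt_sqTheta3 hT) n3).congr_deriv ?_
    congr 1
    simp only [mul_pow, div_pow, hc, e3]
    ring
  · refine (hasDerivAt_weight_one c hdet hl (differentiableAt_sqTheta4 hT) n4).congr_deriv ?_
    congr 1
    simp only [mul_pow, div_pow, hc, e4]
    ring
  · have h2 : HasDerivAt (fun τ => γ * τ + δ) γ τ := by
      simpa using ((hasDerivAt_id τ).const_mul γ).add_const δ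
    have h3 := (differentiableAt_thetaU hT).hasDerivAt.comp τ (hasDerivAt_linFrac hdet hl)
    refine ((h3.fun_div (h2.fun_pow 2) (pow_ne_zero 2 hl)).fun_sub
      ((hasDerivAt_const τ γ).fun_div h2 hl)).congr_deriv ?_
    have hc4 : c ^ 4 = (Real.pi * I / 6) ^ 2 := by rw [← hc]; ring
    simp only [Function.comp_apply, mul_pow, div_pow, hc, hc4, deriv_thetaU hT]
    field_simp
    push_cast
    ring

/-! ### Surjectivity of `ϑ₄² / ϑ₃²` -/

/-- The modular form `ϑ₃⁸ - ϑ₃⁴ϑ₄⁴ + ϑ₄⁸` and the discriminant have quotients of all values. -/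
theorem exists_theta_invariant_eq (c : ℂ) : ∃ τ : ℂ, 0 < τ.im ∧
    (sqTheta3 τ ^ 4 - sqTheta3 τ ^ 2 * sqTheta4 τ ^ 2 + sqTheta4 τ ^ 4) ^ 3 =
      c * (sqTheta2 τ * sqTheta3 τ * sqTheta4 τ) ^ 4 := by
  by_contra hne
  push Not at hne
  have hI : I ^ 2 = -1 := I_sq
  have hI4 : I ^ 4 = 1 := I_pow_four
  set E : ℂ → ℂ := fun τ => sqTheta3 τ ^ 4 - sqTheta3 τ ^ 2 * sqTheta4 τ ^ 2 + sqTheta4 τ ^ 4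
    with hE
  set D : ℂ → ℂ := fun τ => (sqTheta2 τ * sqTheta3 τ * sqTheta4 τ) ^ 4 with hD
  have hne' : ∀ τ : ℂ, 0 < τ.im → E τ ^ 3 - c * D τ ≠ 0 := fun τ hτ => sub_ne_zero.2 (hne τ hτ)
  have dE : ∀ τ : ℂ, 0 < τ.im → DifferentiableAt ℂ E τ := fun τ hτ => by
    have := differentiableAt_sqTheta3 hτ
    have := differentiableAt_sqTheta4 hτ
    fun_prop
  have dD : ∀ τ : ℂ, 0 < τ.im → DifferentiableAt ℂ D τ := fun τ hτ => by
    have := differentiableAt_sqTheta2 hτ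
    have := differentiableAt_sqTheta3 hτ
    have := differentiableAt_sqTheta4 hτ
    fun_prop
  have ET : ∀ τ, E (τ + 1) = E τ := fun τ => by
    simp only [hE, sqTheta3_add_one, sqTheta4_add_one]
    ring
  have DT : ∀ τ, D (τ + 1) = D τ := fun τ => by
    simp only [hD, sqTheta2_add_one, sqTheta3_add_one, sqTheta4_add_one, mul_pow, hI4]
    ring
  have ES : ∀ τ : ℂ, 0 < τ.im → E (-1 / τ) = τ ^ 4 * E τ := fun τ hτ => by
    have h4 : sqTheta2 τ ^ 4 = (sqTheta3 τ ^ 2 - sqTheta4 τ ^ 2) ^ 2 := by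
      rw [← sqTheta2_sq hτ]; ring
    simp only [hE, sqTheta3_neg_one_div hτ, sqTheta4_neg_one_div hτ, mul_pow, neg_sq,
      neg_pow I 4, hI, hI4, sqTheta2_sq hτ, h4]
    ring
  have DS : ∀ τ : ℂ, 0 < τ.im → D (-1 / τ) = τ ^ 12 * D τ := fun τ hτ => by
    simp only [hD, sqTheta2_neg_one_div hτ, sqTheta3_neg_one_div hτ, sqTheta4_neg_one_div hτ,
      mul_pow, neg_pow I 4, hI4]
    ring
  have lE : Filter.Tendsto E (Filter.comap Complex.im Filter.atTop) (nhds 1) := by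
    simpa using ((tendsto_sqTheta3.pow 4).sub ((tendsto_sqTheta3.pow 2).mul
      (tendsto_sqTheta4.pow 2))).add (tendsto_sqTheta4.pow 4)
  have lD : Filter.Tendsto D (Filter.comap Complex.im Filter.atTop) (nhds 0) := by
    simpa using ((tendsto_sqTheta2.mul tendsto_sqTheta3).mul tendsto_sqTheta4).pow 4
  have hI0 : 0 < I.im := by simp
  -- If `E³ - cD` had no zero, `D / (E³ - cD)` would be a cusp form of weight 0, hence zero,
  -- contrary to `D(i) ≠ 0`.
  have h0 := eq_zero_of_weight_lt_twelve (k := 0) (F := fun τ => D τ / (E τ ^ 3 - c * D τ))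
    (by norm_num)
    (fun τ hτ => (dD τ hτ).fun_div (((dE τ hτ).fun_pow 3).fun_sub ((dD τ hτ).const_mul c))
      (hne' τ hτ))
    (fun τ _ => by simp only [ET, DT])
    (fun τ hτ => by
      have h12 : τ ^ 12 ≠ 0 := pow_ne_zero _ (ne_zero_of_im_pos hτ)
      have : (τ ^ 4 * E τ) ^ 3 - c * (τ ^ 12 * D τ) = τ ^ 12 * (E τ ^ 3 - c * D τ) := by ring
      simp only [ES τ hτ, DS τ hτ, this, pow_zero, one_mul]
      exact mul_div_mul_left _ _ h12)
    (by
      have := lD.div ((lE.pow 3).sub (lD.const_mul c)) (by norm_num)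
      rwa [zero_div] at this) hI0
  obtain ⟨n2, n3, n4⟩ := sqTheta_ne_zero hI0
  exact div_ne_zero (pow_ne_zero 4 (mul_ne_zero (mul_ne_zero n2 n3) n4)) (hne' I hI0) h0

/-- Equality of `j`-invariants as functions of the modulus: the fibre is the orbit of six
cross-ratios. -/
theorem modular_invariant_eq_iff {s m : ℂ} : (1 - m + m ^ 2) ^ 3 * (s ^ 2 * (1 - s) ^ 2) =
    (1 - s + s ^ 2) ^ 3 * (m ^ 2 * (1 - m) ^ 2) ↔ s = m ∨ s * m = 1 ∨ s = 1 - m ∨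
      s * (1 - m) = 1 ∨ s * m = m - 1 ∨ s * (m - 1) = m := by
  have key : (1 - m + m ^ 2) ^ 3 * (s ^ 2 * (1 - s) ^ 2) -
      (1 - s + s ^ 2) ^ 3 * (m ^ 2 * (1 - m) ^ 2) = (s - m) * ((s * m - 1) * ((s - (1 - m)) *
        ((s * (1 - m) - 1) * ((s * m - (m - 1)) * (s * (m - 1) - m))))) := by ring
  rw [← sub_eq_zero, key]
  simp only [mul_eq_zero, sub_eq_zero]

theorem exists_sqTheta4_sq_eq {s : ℂ} (h0 : s ≠ 0) (h1 : s ≠ 1) :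
    ∃ τ : ℂ, 0 < τ.im ∧ sqTheta4 τ ^ 2 = s * sqTheta3 τ ^ 2 := by
  have hI : I ^ 2 = -1 := I_sq
  obtain ⟨τ, hτ, h⟩ := exists_theta_invariant_eq ((1 - s + s ^ 2) ^ 3 / (s ^ 2 * (1 - s) ^ 2))
  obtain ⟨n2, n3, n4⟩ := sqTheta_ne_zero hτ
  obtain ⟨m, hm⟩ : ∃ m, sqTheta4 τ ^ 2 = m * sqTheta3 τ ^ 2 :=
    ⟨_, (div_mul_cancel₀ _ (pow_ne_zero 2 n3)).symm⟩
  have hJ := sqTheta2_sq hτ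
  have h1s : 1 - s ≠ 0 := sub_ne_zero.2 h1.symm
  have hr : sqTheta2 τ ^ 2 = (1 - m) * sqTheta3 τ ^ 2 := by rw [hJ, hm]; ring
  have key : (1 - m + m ^ 2) ^ 3 * (s ^ 2 * (1 - s) ^ 2) =
      (1 - s + s ^ 2) ^ 3 * (m ^ 2 * (1 - m) ^ 2) := by
    have e1 : sqTheta3 τ ^ 4 - sqTheta3 τ ^ 2 * sqTheta4 τ ^ 2 + sqTheta4 τ ^ 4 =
        (1 - m + m ^ 2) * sqTheta3 τ ^ 4 := by
      linear_combination (sqTheta4 τ ^ 2 + m * sqTheta3 τ ^ 2 - sqTheta3 τ ^ 2) * hm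
    have e2 : (sqTheta2 τ * sqTheta3 τ * sqTheta4 τ) ^ 4 =
        (1 - m) ^ 2 * m ^ 2 * sqTheta3 τ ^ 12 := by
      rw [show (sqTheta2 τ * sqTheta3 τ * sqTheta4 τ) ^ 4 =
        (sqTheta2 τ ^ 2) ^ 2 * sqTheta3 τ ^ 4 * (sqTheta4 τ ^ 2) ^ 2 by ring, hr, hm]
      ring
    rw [e1, e2] at h
    have h12 : sqTheta3 τ ^ 12 ≠ 0 := pow_ne_zero _ n3
    refine mul_right_cancel₀ h12 ?_
    field_simp at h
    linear_combination sqTheta3 τ ^ 12 * h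
  have hτ0 := ne_zero_of_im_pos hτ
  have hτ1 : 0 < (τ + 1).im := by simpa using hτ
  have hT4 := sqTheta4_add_one
  have hT3 := sqTheta3_add_one
  -- The generators act on `m = ϑ₄⁴ / ϑ₃⁴` by `m ↦ 1/m` and `m ↦ 1 - m`, so six words in them
  -- realize the six cross-ratios.
  rcases modular_invariant_eq_iff.1 key with e | e | e | e | e | e
  · exact ⟨τ, hτ, by rw [hm, e]⟩
  · refine ⟨τ + 1, hτ1, ?_⟩
    rw [hT4, hT3]
    linear_combination -s * hm - sqTheta3 τ ^ 2 * e
  · refine ⟨-1 / τ, neg_one_div_im_pos hτ, ?_⟩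
    rw [sqTheta4_neg_one_div hτ, sqTheta3_neg_one_div hτ]
    linear_combination (-I * τ) ^ 2 * (hr - sqTheta3 τ ^ 2 * e)
  · refine ⟨-1 / τ + 1, by simpa using neg_one_div_im_pos hτ, ?_⟩
    rw [hT4, hT3, sqTheta4_neg_one_div hτ, sqTheta3_neg_one_div hτ]
    linear_combination (-I * τ) ^ 2 * (-s * hr - sqTheta3 τ ^ 2 * e)
  · refine ⟨-1 / (τ + 1), neg_one_div_im_pos hτ1, ?_⟩
    rw [sqTheta4_neg_one_div hτ1, sqTheta3_neg_one_div hτ1, sqTheta2_add_one, hT3]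
    linear_combination (-I * (τ + 1)) ^ 2 *
      (-hr + sqTheta2 τ ^ 2 * hI - s * hm - sqTheta3 τ ^ 2 * e)
  · refine ⟨-1 / (τ + 1) + 1, by simpa using neg_one_div_im_pos hτ1, ?_⟩
    rw [hT4, hT3, sqTheta4_neg_one_div hτ1, sqTheta3_neg_one_div hτ1, sqTheta2_add_one, hT3]
    linear_combination (-I * (τ + 1)) ^ 2 *
      (hm + s * hr - s * sqTheta2 τ ^ 2 * hI - sqTheta3 τ ^ 2 * e)

/-- `ϑ₄² / ϑ₃²` takes every value apart from `0` and `±1`. -/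
theorem exists_sqTheta4_eq {r : ℂ} (h0 : r ≠ 0) (h1 : r ^ 2 ≠ 1) :
    ∃ τ : ℂ, 0 < τ.im ∧ sqTheta4 τ = r * sqTheta3 τ := by
  obtain ⟨τ, hτ, h⟩ := exists_sqTheta4_sq_eq (pow_ne_zero 2 h0) h1
  rw [← mul_pow] at h
  rcases sq_eq_sq_iff_eq_or_eq_neg.1 h with e | e
  · exact ⟨τ, hτ, e⟩
  -- The wrong sign is repaired by the substitution `τ ↦ -1/(-1/τ + 2)`: the shift by two negates
  -- `ϑ₂²` and fixes `ϑ₃²`.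
  · have hτ1 := neg_one_div_im_pos hτ
    have hτ2 : 0 < (-1 / τ + 1 + 1).im := by simpa using hτ1
    refine ⟨-1 / (-1 / τ + 1 + 1), neg_one_div_im_pos hτ2, ?_⟩
    rw [sqTheta4_neg_one_div hτ2, sqTheta3_neg_one_div hτ2, sqTheta2_add_one, sqTheta2_add_one,
      sqTheta3_add_one, sqTheta4_add_one, sqTheta3_neg_one_div hτ, sqTheta2_neg_one_div hτ, e]
    linear_combination (-I * (-1 / τ + 1 + 1)) * (-I * τ) * (-r * sqTheta3 τ) * I_sq

/-! ### A lower bound for the theta constants -/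

/-- With `q = e^(-π Im τ) ≤ 3/10` one has `|ϑ₃ - 1| ≤ 2q / (1 - q) ≤ 6/7`. -/
theorem sqTheta3_lower_bound {τ : ℂ} (hτ : 1 / 2 ≤ τ.im) : (1 / 7 : ℝ) ^ 2 ≤ ‖sqTheta3 τ‖ := by
  have hτ0 : 0 < τ.im := by linarith
  have h1 := norm_jacobiTheta_sub_one_le hτ0
  rw [← theta3_eq_jacobiTheta] at h1
  have hq : Real.exp (-Real.pi * τ.im) ≤ 3 / 10 := by
    have h2 : (1 : ℝ) + 1.5 + 1.5 ^ 2 / 2 ≤ Real.exp 1.5 :=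
      Real.quadratic_le_exp_of_nonneg (by norm_num)
    have h3 : Real.exp (-Real.pi * τ.im) ≤ Real.exp (-1.5) := by
      rw [Real.exp_le_exp]
      nlinarith [Real.pi_gt_three]
    rw [Real.exp_neg] at h3
    refine h3.trans (inv_le_of_inv_le₀ (by norm_num) ?_)
    norm_num at h2 ⊢
    linarith
  have hq0 := Real.exp_pos (-Real.pi * τ.im)
  have h2 : 2 / (1 - Real.exp (-Real.pi * τ.im)) * Real.exp (-Real.pi * τ.im) ≤ 6 / 7 := by
    rw [div_mul_eq_mul_div, div_le_iff₀ (by linarith)]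
    linarith
  have h3 : 1 / 7 ≤ ‖theta3 τ‖ := by
    have := norm_sub_norm_le (1 : ℂ) (theta3 τ)
    rw [norm_one, norm_sub_rev] at this
    linarith
  rw [sqTheta3, norm_pow]
  gcongr

/-- `(|ϑ₂|⁸ + |ϑ₃|⁸ + |ϑ₄|⁸) (Im τ)²`, a function invariant under the modular group. -/
def thetaHeight (τ : ℂ) : ℝ :=
  (‖sqTheta2 τ‖ ^ 4 + ‖sqTheta3 τ‖ ^ 4 + ‖sqTheta4 τ‖ ^ 4) * τ.im ^ 2

open UpperHalfPlane ModularForm MatrixGroups in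
-- Both generators permute the three norms; the factor `|τ|⁴` from `-1/τ` cancels against `(Im τ)²`.
-- The weight zero slash action passes from generators to the group.
theorem thetaHeight_smul (g : SL(2, ℤ)) (τ : ℍ) :
    thetaHeight ((g • τ : ℍ) : ℂ) = thetaHeight τ := by
  have slS : (fun τ : ℍ => (thetaHeight τ : ℂ)) ∣[(0 : ℤ)] ModularGroup.S =
      fun τ : ℍ => (thetaHeight τ : ℂ) := by
    ext τ
    have hτ : (τ : ℂ) ≠ 0 := τ.ne_zero
    have hτ' : ‖(τ : ℂ)‖ ≠ 0 := norm_ne_zero_iff.2 hτ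
    have hp : 0 < (τ : ℂ).im := τ.2
    rw [ModularForm.SL_slash_apply, UpperHalfPlane.modular_S_smul]
    have him : (-1 / (τ : ℂ)).im = (τ : ℂ).im / ‖(τ : ℂ)‖ ^ 2 := by
      rw [neg_div, one_div, neg_im, inv_im, neg_div, neg_neg, normSq_eq_norm_sq]
    have h1 : thetaHeight (-1 / (τ : ℂ)) = thetaHeight τ := by
      rw [thetaHeight, sqTheta2_neg_one_div hp, sqTheta3_neg_one_div hp, sqTheta4_neg_one_div hp,
        him, thetaHeight]
      simp only [norm_mul, norm_neg, norm_I, one_mul, mul_pow]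
      field_simp
      ring
    rw [UpperHalfPlane.coe_mk, inv_neg, ← one_div, ← neg_div, h1]
    simp
  have slT : (fun τ : ℍ => (thetaHeight τ : ℂ)) ∣[(0 : ℤ)] ModularGroup.T =
      fun τ : ℍ => (thetaHeight τ : ℂ) := by
    ext τ
    have h1 : thetaHeight ((τ : ℂ) + 1) = thetaHeight τ := by
      simp only [thetaHeight, sqTheta2_add_one, sqTheta3_add_one, sqTheta4_add_one, norm_mul,
        norm_I, one_mul, add_im, one_im, add_zero]
      ring
    rw [ModularForm.SL_slash_apply, UpperHalfPlane.modular_T_smul]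
    simp [add_comm, h1]
  have := congrFun (SlashInvariantForm.slash_action_generators_SL2Z slS slT g) τ
  rw [ModularForm.SL_slash_apply] at this
  simpa using this

open UpperHalfPlane in
-- Every orbit meets `Im τ ≥ 1/2`, where the `ϑ₃` term alone gives the bound.
theorem exists_thetaHeight_lower_bound :
    ∃ m : ℝ, 0 < m ∧ ∀ τ : ℂ, 0 < τ.im → m ≤ thetaHeight τ := by
  refine ⟨((1 / 7 : ℝ) ^ 2) ^ 4 * (1 / 2) ^ 2, by positivity, fun τ hτ => ?_⟩
  obtain ⟨g, hg, -⟩ := ModularGroup.exists_one_half_le_im_smul_and_norm_denom_le ⟨τ, hτ⟩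
  have h1 := thetaHeight_smul g ⟨τ, hτ⟩
  rw [UpperHalfPlane.coe_mk] at h1
  rw [← h1, thetaHeight]
  have hg' : 1 / 2 ≤ ((g • (⟨τ, hτ⟩ : ℍ) : ℍ) : ℂ).im := hg
  have h3 := sqTheta3_lower_bound hg'
  have h4 : ((1 / 7 : ℝ) ^ 2) ^ 4 ≤ ‖sqTheta3 ((g • (⟨τ, hτ⟩ : ℍ) : ℍ) : ℂ)‖ ^ 4 := by gcongr
  gcongr
  refine h4.trans ?_
  have : 0 ≤ ‖sqTheta2 ((g • (⟨τ, hτ⟩ : ℍ) : ℍ) : ℂ)‖ ^ 4 := by positivity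
  have : 0 ≤ ‖sqTheta4 ((g • (⟨τ, hτ⟩ : ℍ) : ℍ) : ℂ)‖ ^ 4 := by positivity
  linarith

/-! ### The general solution -/

theorem IsCanonicalSolution.exists_theta {c : ℂ} {U : Set ℂ} {x y z u : ℂ → ℂ} {τ₀ : ℂ}
    (hc : c ^ 2 = Real.pi * I / 6) (hU : IsOpen U) (hconn : IsPreconnected U) (h₀ : τ₀ ∈ U)
    (h : IsCanonicalSolution U x y z u) (hy : y τ₀ ≠ 0) (hz : z τ₀ ≠ 0)
    (hyz : y τ₀ ^ 2 ≠ z τ₀ ^ 2) :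
    ∃ ε α β γ δ : ℂ, α * δ - β * γ = 1 ∧ (ε ≠ 0 ↔ x τ₀ ≠ 0) ∧
      ∀ τ ∈ U, τ ∈ linFracDomain α β γ δ ∧
        x τ = ε * (sqTheta2 (linFrac α β γ δ τ) / (γ * τ + δ)) ∧
        y τ = c * (sqTheta3 (linFrac α β γ δ τ) / (γ * τ + δ)) ∧
        z τ = c * (sqTheta4 (linFrac α β γ δ τ) / (γ * τ + δ)) ∧
        u τ = thetaU (linFrac α β γ δ τ) / (γ * τ + δ) ^ 2 - γ / (γ * τ + δ) := by
  have hpi : (Real.pi : ℂ) ≠ 0 := by exact_mod_cast Real.pi_ne_zero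
  have hc0 : c ≠ 0 := by
    rintro rfl
    have : (Real.pi * I / 6 : ℂ) ≠ 0 := by simp [hpi, I_ne_zero]
    exact this (by rw [← hc]; simp)
  -- `T` is the value of the substitution at `τ₀`, fixed by `z/y`; `l` is the value of `γτ₀ + δ`,
  -- fixed by `y`. Then `u` determines `γ`, the determinant determines `α`, and `x` determines `ε`.
  obtain ⟨T, hT, hT4⟩ := exists_sqTheta4_eq (r := z τ₀ / y τ₀) (div_ne_zero hz hy) (by
    rw [div_pow, Ne, div_eq_one_iff_eq (pow_ne_zero 2 hy)]
    exact hyz.symm)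
  obtain ⟨n2, n3, n4⟩ := sqTheta_ne_zero hT
  obtain ⟨l, hl⟩ : ∃ l, l = c * sqTheta3 T / y τ₀ := ⟨_, rfl⟩
  have hl0 : l ≠ 0 := by rw [hl]; exact div_ne_zero (mul_ne_zero hc0 n3) hy
  obtain ⟨γ, hγ⟩ : ∃ γ, γ = (thetaU T / l ^ 2 - u τ₀) * l := ⟨_, rfl⟩
  obtain ⟨δ, hδ⟩ : ∃ δ, δ = l - γ * τ₀ := ⟨_, rfl⟩
  obtain ⟨α, hα⟩ : ∃ α, α = (1 + γ * T * l) / l := ⟨_, rfl⟩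
  obtain ⟨β, hβ⟩ : ∃ β, β = T * l - α * τ₀ := ⟨_, rfl⟩
  obtain ⟨ε, hε⟩ : ∃ ε, ε = x τ₀ * l / sqTheta2 T := ⟨_, rfl⟩
  have hdet : α * δ - β * γ = 1 := by
    rw [hβ, hδ]
    have : α * l = 1 + γ * T * l := by rw [hα, div_mul_cancel₀ _ hl0]
    linear_combination this
  have eden : γ * τ₀ + δ = l := by rw [hδ]; ring
  have eT : linFrac α β γ δ τ₀ = T := by
    rw [linFrac, eden, hβ]
    field_simp
    ring
  have hmem : τ₀ ∈ linFracDomain α β γ δ := ⟨by rwa [eden], by rwa [eT]⟩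
  refine ⟨ε, α, β, γ, δ, hdet, ?_, h.eqOn_of_eq (isCanonicalSolution_theta hc hdet) hU hconn
    (isOpen_linFracDomain α β γ δ) h₀ hmem ?_ ?_ ?_ ?_ ?_⟩
  · rw [hε]
    simp [hl0, n2]
  · rw [eT, eden, hε]
    field_simp
  · rw [eT, eden, hl]
    field_simp
  · rw [eT, eden, hl, hT4]
    field_simp
  · rw [eT, eden, hγ]
    field_simp
    ring
  -- `N Y²` equals `|c|⁴` times `thetaHeight` of the substituted point wherever the solutions agree,
  -- so it is bounded below. `N` and `Y` are continuous at the limit point, which excludes `Y = 0`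
  -- there.
  · intro τ hτ hcl
    obtain ⟨m, hm, hbound⟩ := exists_thetaHeight_lower_bound
    obtain ⟨-, cy, cz, -⟩ := h.continuousAt hτ
    let N : ℂ → ℝ := fun w => ‖y w ^ 2 - z w ^ 2‖ ^ 2 + ‖y w‖ ^ 4 + ‖z w‖ ^ 4
    let Y : ℂ → ℝ := fun w => ((α * w + β) * (starRingEnd ℂ) (γ * w + δ)).im
    have cN : ContinuousAt N τ := by fun_prop
    have cY : ContinuousAt Y τ := by fun_prop
    have hb : ∀ w, ((w ∈ U ∧ w ∈ linFracDomain α β γ δ) ∧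
        x w = ε * (sqTheta2 (linFrac α β γ δ w) / (γ * w + δ)) ∧
        y w = c * (sqTheta3 (linFrac α β γ δ w) / (γ * w + δ)) ∧
        z w = c * (sqTheta4 (linFrac α β γ δ w) / (γ * w + δ)) ∧
        u w = thetaU (linFrac α β γ δ w) / (γ * w + δ) ^ 2 - γ / (γ * w + δ)) →
        0 ≤ Y w ∧ ‖c‖ ^ 4 * m ≤ N w * Y w ^ 2 := by
      rintro w ⟨⟨-, hw⟩, -, hyw, hzw, -⟩
      have hYw : 0 < Y w := by
        have := hw
        rwa [linFracDomain_eq] at this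
      obtain ⟨hlw, hTw⟩ := hw
      refine ⟨hYw.le, ?_⟩
      have e1 : y w ^ 2 - z w ^ 2 = c ^ 2 * (sqTheta2 (linFrac α β γ δ w) ^ 2 / (γ * w + δ) ^ 2) := by
        rw [hyw, hzw, sqTheta2_sq hTw]
        generalize γ * w + δ = v
        ring
      have e2 : (linFrac α β γ δ w).im = Y w / ‖γ * w + δ‖ ^ 2 := by
        rw [linFrac, div_eq_mul_inv, inv_def, ← mul_assoc, im_mul_ofReal, normSq_eq_norm_sq,
          div_eq_mul_inv]
      have hn : ‖γ * w + δ‖ ≠ 0 := norm_ne_zero_iff.2 hlw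
      have e3 : N w * Y w ^ 2 = ‖c‖ ^ 4 * thetaHeight (linFrac α β γ δ w) := by
        simp only [N, e1, thetaHeight, e2]
        rw [hyw, hzw]
        simp only [norm_mul, norm_div, norm_pow]
        field_simp
      rw [e3]
      exact mul_le_mul_of_nonneg_left (hbound _ hTw) (by positivity)
    have hclo : 0 ≤ Y τ ∧ ‖c‖ ^ 4 * m ≤ N τ * Y τ ^ 2 := by
      have hne := mem_closure_iff_nhdsWithin_neBot.1 hcl
      set L := nhdsWithin τ _ with hL
      have hLn : L ≤ nhds τ := nhdsWithin_le_nhds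
      constructor
      · refine ge_of_tendsto (cY.tendsto.mono_left hLn) ?_
        filter_upwards [self_mem_nhdsWithin] with w hw using (hb w hw).1
      · refine ge_of_tendsto ((cN.mul (cY.pow 2)).tendsto.mono_left hLn) ?_
        filter_upwards [self_mem_nhdsWithin] with w hw using (hb w hw).2
    rw [linFracDomain_eq]
    refine lt_of_le_of_ne hclo.1 fun h0 => ?_
    have h1 := hclo.2
    have h2 : Y τ = 0 := h0.symm
    rw [h2] at h1
    have : 0 < ‖c‖ ^ 4 * m := mul_pos (pow_pos (norm_pos_iff.2 hc0) 4) hm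
    norm_num at h1
    linarith

end

/-! ### The full statement. -/

theorem theorem5 :
    -- Equivalence of the two systems.
    -- On solutions of the canonical system the quantity `(y² - z²) / (π x²)` is constant.
    (∀ (U : Set ℂ) (x y z u : ℂ → ℂ) (τ₀ : ℂ), IsOpen U → IsPreconnected U → τ₀ ∈ U →
      IsCanonicalSolution U x y z u →
      x τ₀ ≠ 0 → y τ₀ ≠ 0 → y τ₀ ^ 2 ≠ z τ₀ ^ 2 →
      ∃ κ : ℂ, ∀ τ ∈ U, OnLevel κ (x τ) (y τ) (z τ)) ∧
    -- The point transformation takes either system to the other one.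
    (∀ (U : Set ℂ) (κ : ℂ) (x y z u A B a b : ℂ → ℂ), IsOpen U →
      ContinuousOn x U → ContinuousOn z U →
      (∀ τ ∈ U, PointRelated κ (x τ) (y τ) (z τ) (u τ) (A τ) (B τ) (a τ) (b τ)) →
      (IsCanonicalSolution U x y z u ↔ IsJacobiSolution U A B a b)) ∧
    -- The image of the point transformation in the phase space.
    (∀ A B a b : ℂ, (∃ κ x y z u : ℂ, PointRelated κ x y z u A B a b) ↔
      A ≠ 0 ∧ a ^ 2 + 32 * b ≠ 0) ∧
    -- Every solution of Jacobi's system in this image comes from a solution of the canonical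
    -- system, through any prescribed preimage of its initial value.
    (∀ (U : Set ℂ) (A B a b : ℂ → ℂ) (τ₀ κ x₀ y₀ z₀ u₀ : ℂ),
      IsOpen U → IsSimplyConnected U → τ₀ ∈ U → IsJacobiSolution U A B a b →
      PointRelated κ x₀ y₀ z₀ u₀ (A τ₀) (B τ₀) (a τ₀) (b τ₀) →
      ∃ x y z u : ℂ → ℂ, x τ₀ = x₀ ∧ y τ₀ = y₀ ∧ z τ₀ = z₀ ∧ u τ₀ = u₀ ∧
        IsCanonicalSolution U x y z u ∧
        ∀ τ ∈ U, PointRelated κ (x τ) (y τ) (z τ) (u τ) (A τ) (B τ) (a τ) (b τ)) ∧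
    -- The theta-functional expressions are solutions; `c` is either square root of `πi/6`.
    (∀ c ε α β γ δ : ℂ, c ^ 2 = Real.pi * I / 6 → α * δ - β * γ = 1 →
      IsCanonicalSolution (linFracDomain α β γ δ)
        (fun τ => ε * (theta2 (linFrac α β γ δ τ) ^ 2 / (γ * τ + δ)))
        (fun τ => c * (theta3 (linFrac α β γ δ τ) ^ 2 / (γ * τ + δ)))
        (fun τ => c * (theta4 (linFrac α β γ δ τ) ^ 2 / (γ * τ + δ)))
        (fun τ => 2 * I / Real.pi * (weierstrassEta (linFrac α β γ δ τ) / (γ * τ + δ) ^ 2)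
          - γ / (γ * τ + δ))) ∧
    -- They form the general solution.
    (∀ (c : ℂ) (U : Set ℂ) (x y z u : ℂ → ℂ) (τ₀ : ℂ), c ^ 2 = Real.pi * I / 6 →
      IsOpen U → IsPreconnected U → τ₀ ∈ U → IsCanonicalSolution U x y z u →
      y τ₀ ≠ 0 → z τ₀ ≠ 0 → y τ₀ ^ 2 ≠ z τ₀ ^ 2 →
      ∃ ε α β γ δ : ℂ, α * δ - β * γ = 1 ∧ (ε ≠ 0 ↔ x τ₀ ≠ 0) ∧
        U ⊆ linFracDomain α β γ δ ∧ ∀ τ ∈ U,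
          x τ = ε * (theta2 (linFrac α β γ δ τ) ^ 2 / (γ * τ + δ)) ∧
          y τ = c * (theta3 (linFrac α β γ δ τ) ^ 2 / (γ * τ + δ)) ∧
          z τ = c * (theta4 (linFrac α β γ δ τ) ^ 2 / (γ * τ + δ)) ∧
          u τ = 2 * I / Real.pi * (weierstrassEta (linFrac α β γ δ τ) / (γ * τ + δ) ^ 2)
            - γ / (γ * τ + δ)) ∧
    -- The elementary two-parameter family with `x = 0`.
    (∀ σ γ δ : ℂ, σ = 1 ∨ σ = -1 →
      IsCanonicalSolution {τ | γ * τ + δ ≠ 0}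
        (fun _ => 0)
        (fun τ => σ / (γ * τ + δ))
        (fun τ => 1 / (γ * τ + δ))
        (fun τ => -((γ ^ 2 * τ + γ * δ - 1) / (γ * τ + δ) ^ 2))) ∧
    -- It consists of all the solutions with `x = 0`, `y² = z² ≠ 0`.
    (∀ (U : Set ℂ) (x y z u : ℂ → ℂ) (τ₀ : ℂ), IsOpen U → IsPreconnected U → τ₀ ∈ U →
      IsCanonicalSolution U x y z u →
      x τ₀ = 0 → y τ₀ ^ 2 = z τ₀ ^ 2 → z τ₀ ≠ 0 →
      ∃ σ γ δ : ℂ, (σ = 1 ∨ σ = -1) ∧ ∀ τ ∈ U,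
        γ * τ + δ ≠ 0 ∧
        x τ = 0 ∧
        y τ = σ / (γ * τ + δ) ∧
        z τ = 1 / (γ * τ + δ) ∧
        u τ = -((γ ^ 2 * τ + γ * δ - 1) / (γ * τ + δ) ^ 2)) := by
  refine ⟨fun U x y z u τ₀ hU hc h₀ h => h.exists_onLevel hU hc h₀,
    fun U κ x y z u A B a b hU cx cz hr => ⟨fun h => h.isJacobiSolution hU hr,
      fun h => h.isCanonicalSolution hU cx cz hr⟩,
    exists_pointRelated_iff,
    fun U A B a b τ₀ κ x₀ y₀ z₀ u₀ hU hs h₀ h hp => h.exists_isCanonicalSolution hU hs h₀ hp,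
    fun c ε α β γ δ hc hdet => ?_,
    fun c U x y z u τ₀ hc hU hconn h₀ h hy hz hyz => ?_,
    fun σ γ δ => isCanonicalSolution_elementary γ δ,
    fun U x y z u τ₀ hU hc h₀ h => h.exists_elementary hU hc h₀⟩
  · have h := isCanonicalSolution_theta (ε := ε) hc hdet
    -- `thetaU` is identified with Weierstrass' `η` only on the upper half-plane; openness of the
    -- domain lets the derivative of `u` be transferred.
    have e : ∀ w ∈ linFracDomain α β γ δ,
        2 * I / Real.pi * (weierstrassEta (linFrac α β γ δ w) / (γ * w + δ) ^ 2) - γ / (γ * w + δ) =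
          thetaU (linFrac α β γ δ w) / (γ * w + δ) ^ 2 - γ / (γ * w + δ) := fun w hw => by
      rw [thetaU_eq_weierstrassEta hw.2, ← mul_div_assoc]
    refine ⟨fun τ hτ => ?_, fun τ hτ => ?_, fun τ hτ => ?_, fun τ hτ => ?_⟩ <;> rw [e τ hτ]
    · exact h.1 τ hτ
    · exact h.2 τ hτ
    · exact h.3 τ hτ
    refine (h.4 τ hτ).congr_of_eventuallyEq ?_
    filter_upwards [(isOpen_linFracDomain α β γ δ).mem_nhds hτ] with w hw using e w hw
  · obtain ⟨ε, α, β, γ, δ, hdet, hε, hsol⟩ := h.exists_theta hc hU hconn h₀ hy hz hyz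
    refine ⟨ε, α, β, γ, δ, hdet, hε, fun τ hτ => (hsol τ hτ).1, fun τ hτ => ?_⟩
    obtain ⟨hmem, hx', hy', hz', hu'⟩ := hsol τ hτ
    exact ⟨hx', hy', hz', by rw [hu', thetaU_eq_weierstrassEta hmem.2, ← mul_div_assoc]⟩
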